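/- **Setting.** Each device $k$ owns $n_k\ge 1$ data points and a differentiable local objective $F_k:\mathbb{R}^d\to\mathbb{R}$ that is $L$-smooth and $\mu$-strongly convex ($L,\mu>0$), with minimum value $F_k^*$. For a finite set $\mathcal{A}$ of devices put $p^k_{\mathcal{A}}=n_k/\sum_{j\in\mathcal{A}}n_j$ and $F_{\mathcal{A}}=\sum_{k\in\mathcal{A}}p^k_{\mathcal{A}}F_k$. Training runs for $T$ rounds of $E\ge1$ local steps. The participating devices are $\mathcal{C}$ in the rounds $\tau<\tau_0$ and $\tilde{\mathcal{C}}$ in the rounds $\tau_0\le\tau<T$, where $0<\tau_0<T$ and, for one device $l$, either $\tilde{\mathcal{C}}=\mathcal{C}\cup\{l\}$ with $l\notin\mathcal{C}$ (arrival) or $\tilde{\mathcal{C}}=\mathcal{C}\setminus\{l\}$ with $l\in\mathcal{C}$ (departure). Let $w^*,\tilde w^*$ be the minimizers of $F_{\mathcal{C}},F_{\tilde{\mathcal{C}}}$, and $\Gamma_k=F_k(w^*)-F_k^*$, $\tilde\Gamma_k=F_k(\tilde w^*)-F_k^*$. In round $\tau$, each participating device $k$ starts from the global weight, $w^k_{\tau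 E}=w_{\tau E}$, and iterates $w^k_{\tau E+i+1}=w^k_{\tau E+i}-\eta_\tau g^k_{\tau E+i}$, where $g^k_t=\nabla F_k(w^k_t,\xi^k_t)$ is a stochastic gradient on a mini-batch $\xi^k_t$; it completes a random number $0\le s^k_\tau\le E$ of these steps. Then $w_{(\tau+1)E}=w_{\tau E}+\sum_k p^k_\tau\,(w^k_{\tau E+s^k_\tau}-w_{\tau E})$ with random coefficients $p^k_\tau\ge0$; sums over $k$ are over the devices participating in the round. Assume $\mathbb{E}\|w_0\|^2<\infty$; the initial weight $w_0$, the participation vectors $(p^k_\tau,s^k_\tau)_k$ of the different rounds $\tau$ and the mini-batches $\xi^k_t$ are mutually independent; the law of $\xi^k_t$ depends only on $k$, and $\mathbb{E}_\xi\nabla F_k(w,\xi)=\nabla F_k(w)$ for all $w$; $\mathbb{E}\|g^k_t-\nabla F_k(w^k_t)\|^2\le\sigma_k^2$ and $\mathbb{E}\|g^k_t\|^2\le G^2$ for all participating $k$ and all $t$; $p^k_\tau\le\theta\,p^k_{\mathcal{C}}$ before the shift and $p^k_\tau\le\tilde\theta\,p^k_{\tilde{\mathcal{C}}}$ after it ($\theta,\tilde\theta>0$).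 Within each of the two phases, the expectations $\mathbb{E}[p^k_\tau s^k_\tau]$, $\mathbb{E}[(p^k_\tau)^2s^k_\tau]$, $\mathbb{E}[(\sum_kp^k_\tau-2)_+\sum_kp^k_\tau s^k_\tau]$ do not vary with $\tau$, and $\mathbb{E}[\sum_kp^k_\tau s^k_\tau]\ne0$. **Constants.** For the phase before the shift, with all sums over $k\in\mathcal{C}$, $p^k=p^k_{\mathcal{C}}$, and expectations taken in any round of the phase, let $S=\mathbb{E}[\sum_kp^k_\tau s^k_\tau]$ and $$\gamma=\max\Big\{\tfrac{32E(1+\theta)L}{\mu S},\tfrac{4E^2\theta}{S}\Big\},\quad D=\frac{64E\sum_k\mathbb{E}[p^k_\tau s^k_\tau]\Gamma_k}{\mu S},\quad M_\tau=\sum_{t=0}^{\tau-1}z_t,$$ $$V=\max\Big\{\gamma^2\,\mathbb{E}\|w_0-w^*\|^2,\ \Big(\tfrac{16E}{\mu S}\Big)^2\tfrac{\mathbb{E}[B_\tau]}{E}\Big\},$$ where $z_t=0$ if $\mathbb{E}[p^k_ts^k_t]/p^k$ has the same value for all $k$ and $z_t=1$ otherwise, and $$B_\tau=2(2+\theta)L\sum_kp^k_\tau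 s^k_\tau\Gamma_k+\Big(2+\tfrac{\mu}{2(1+\theta)L}\Big)E(E-1)G^2\Big(\sum_kp^k_\tau s^k_\tau+\theta\big(\sum_kp^k_\tau-2\big)_+\sum_kp^k_\tau s^k_\tau\Big)+2EG^2\sum_k\tfrac{(p^k_\tau)^2}{p^k}s^k_\tau+\sum_k(p^k_\tau)^2s^k_\tau\sigma_k^2 .$$ For the phase after the shift, $\tilde S,\tilde\gamma,\tilde D,\tilde B_\tau$ are defined in the same way from $\tilde{\mathcal{C}},\tilde\theta,\tilde\Gamma_k$, and $\tilde M_\tau=\sum_{t=\tau_0}^{\tau-1}\tilde z_t$. For a number $\Delta_{\tau_0}$ let $$\tilde V=\max\Big\{\tilde\gamma^2\big(\sqrt{\Delta_{\tau_0}}+\|w^*-\tilde w^*\|\big)^2,\ \Big(\tfrac{16E}{\mu\tilde S}\Big)^2\tfrac{\mathbb{E}[\tilde B_\tau]}{E}\Big\}.$$ **Claim.** Let the learning rates before the shift be arbitrary, and restart the learning rate at the shift: $\eta_\tau=\frac{16E}{\mu\tilde S}\cdot\frac{1}{(\tau-\tau_0)E+\tilde\gamma}$ for $\tau_0\le\tau<T$.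 1. If $\mathbb{E}\|w_{\tau_0E}-w^*\|^2\le\Delta_{\tau_0}$, then for all $\tau_0\le\tau\le T$ the variable $\|w_{\tau E}-\tilde w^*\|^2$ is integrable and $$\mathbb{E}\|w_{\tau E}-\tilde w^*\|^2\le\frac{\tilde M_\tau\tilde D+\tilde V}{(\tau-\tau_0)E+\tilde\gamma}.$$ 2. The first term of $\tilde V$ is of order $\frac{V}{\tau_0E+\gamma}+\Gamma_l$ as soon as $\Delta_{\tau_0}$ is of order $\frac{V}{\tau_0E+\gamma}$. Precisely: if $\mathbb{E}\|w_{\tau_0E}-w^*\|^2\le\Delta_{\tau_0}\le\kappa\frac{V}{\tau_0E+\gamma}$, then in the arrival case $$\tilde\gamma^2\big(\sqrt{\Delta_{\tau_0}}+\|w^*-\tilde w^*\|\big)^2\le K\Big(\frac{V}{\tau_0E+\gamma}+\Gamma_l\Big)$$ with a constant $K$ that depends only on $\kappa,\tilde\gamma,L,\mu$; in the departure case the same holds with $\tilde\Gamma_l$ in place of $\Gamma_l$, and it also holds with $\Gamma_l$ and a constant that depends only on $\kappa,\tilde\gamma,L,\mu$ and $n_l/\sum_{k\in\tilde{\mathcal{C}}}n_k$.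 3. If $\eta_\tau=\frac{16E}{\mu S}\cdot\frac{1}{\tau E+\gamma}$ for all $\tau<\tau_0$, then $\Delta_{\tau_0}=\frac{M_{\tau_0}D+V}{\tau_0E+\gamma}$ is an admissible bound, that is, $\mathbb{E}\|w_{\tau_0E}-w^*\|^2\le\frac{M_{\tau_0}D+V}{\tau_0E+\gamma}$. -/

import Mathlib

open MeasureTheory ProbabilityTheory Finset Set
open scoped Gradient ENNReal

/-- Federated training with one objective shift: the raw data, without any assumption.
The model parameters live in `ℝ^d`; `ι` is the type of all devices that ever take part, `Ξ` the
space of mini-batches, `Ω` the sample space. -/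
structure FedRun (d : ℕ) (ι Ξ Ω : Type*) [MeasurableSpace Ξ] [MeasurableSpace Ω] where
  /-- number of local steps in a round -/
  E : ℕ
  /-- number of rounds -/
  T : ℕ
  /-- the round at which the objective shifts -/
  τ₀ : ℕ
  /-- smoothness constant -/
  L : ℝ
  /-- strong convexity constant -/
  μ : ℝ
  /-- bound on the stochastic gradients -/
  G : ℝ
  /-- bound on the aggregation coefficients before the shift -/
  θ : ℝ
  /-- bound on the aggregation coefficients after the shift -/
  θ' : ℝ
  /-- number of data points of each device -/
  n : ι → ℕ
  /-- noise levels of the stochastic gradients -/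
  σ : ι → ℝ
  /-- local objectives -/
  F : ι → EuclideanSpace ℝ (Fin d) → ℝ
  /-- the device that arrives or departs -/
  l : ι
  /-- participating devices before the shift -/
  C : Finset ι
  /-- participating devices after the shift -/
  C' : Finset ι
  /-- minimizer of the objective before the shift -/
  wopt : EuclideanSpace ℝ (Fin d)
  /-- minimizer of the objective after the shift -/
  wopt' : EuclideanSpace ℝ (Fin d)
  /-- stochastic gradients: `grad k w x` is the gradient of device `k` at `w` on mini-batch `x` -/
  grad : ι → EuclideanSpace ℝ (Fin d) → Ξ → EuclideanSpace ℝ (Fin d)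
  /-- law of a mini-batch of each device -/
  ν : ι → Measure Ξ
  /-- the probability -/
  P : Measure Ω
  /-- initial global weight -/
  w₀ : Ω → EuclideanSpace ℝ (Fin d)
  /-- aggregation coefficients `p τ k` -/
  p : ℕ → ι → Ω → ℝ
  /-- numbers `s τ k` of completed local steps -/
  s : ℕ → ι → Ω → ℕ
  /-- mini-batches: `ξ τ k i` is used by device `k` in the `i`-th local step of round `τ` -/
  ξ : ℕ → ι → ℕ → Ω → Ξ
  /-- learning rates used before the shift -/
  η₀ : ℕ → ℝ

/-- The independent sources of randomness: the initial weight, the participation of the devices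
in a round, and the individual mini-batches. -/
inductive FedSource (ι : Type*) where
  | init : FedSource ι
  | part (τ : ℕ) : FedSource ι
  | batch (τ : ℕ) (k : ι) (i : ℕ) : FedSource ι

/-- Local SGD with constant step `η`, stochastic gradient `g` and mini-batches `x`, from `w`. -/
noncomputable def localSGD {d : ℕ} {Ξ : Type*} (η : ℝ)
    (g : EuclideanSpace ℝ (Fin d) → Ξ → EuclideanSpace ℝ (Fin d)) (x : ℕ → Ξ)
    (w : EuclideanSpace ℝ (Fin d)) : ℕ → EuclideanSpace ℝ (Fin d)
  | 0 => w
  | i + 1 => localSGD η g x w i - η • g (localSGD η g x w i) (x i)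

namespace FedRun

noncomputable section

variable {d : ℕ} {ι Ξ Ω : Type*} [MeasurableSpace Ξ] [MeasurableSpace Ω]

/-! Objectives. Below, `A` is a set of participating devices. -/

/-- `p^k = n_k / n` for the set `A` of participating devices. -/
def weight (R : FedRun d ι Ξ Ω) (A : Finset ι) (k : ι) : ℝ :=
  (R.n k : ℝ) / ∑ j ∈ A, (R.n j : ℝ)

/-- The global objective `∑ p^k F_k` of the set `A`. -/
def objective (R : FedRun d ι Ξ Ω) (A : Finset ι) (w : EuclideanSpace ℝ (Fin d)) : ℝ :=
  ∑ k ∈ A, R.weight A k * R.F k w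

/-- `F_k(v) - F_k^*`, where `F_k^*` is the minimum value of `F_k`. -/
def gap (R : FedRun d ι Ξ Ω) (v : EuclideanSpace ℝ (Fin d)) (k : ι) : ℝ :=
  R.F k v - ⨅ w, R.F k w

/-- Device `l` joins. -/
def Arrival (R : FedRun d ι Ξ Ω) : Prop :=
  R.l ∉ R.C ∧ ∀ k, k ∈ R.C' ↔ k = R.l ∨ k ∈ R.C

/-- Device `l` leaves. -/
def Departure (R : FedRun d ι Ξ Ω) : Prop :=
  R.l ∈ R.C ∧ ∀ k, k ∈ R.C' ↔ k ≠ R.l ∧ k ∈ R.C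

/-! The constants of the convergence bound, for participating devices `A`, coefficient bound `θ`,
minimizer `v`. The moments involved are constant within each of the two phases of the training
(see `SameMoments`), and are evaluated at a round `r` of the phase. -/

/-- `𝔼[p_r^k s_r^k]`. -/
def work (R : FedRun d ι Ξ Ω) (r : ℕ) (k : ι) : ℝ :=
  ∫ ω, R.p r k ω * (R.s r k ω : ℝ) ∂(R.P)

/-- `𝔼[∑_k p_r^k s_r^k]`. -/
def totalWork (R : FedRun d ι Ξ Ω) (A : Finset ι) (r : ℕ) : ℝ :=
  ∫ ω, ∑ k ∈ A, R.p r k ω * (R.s r k ω : ℝ) ∂(R.P)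

/-- `𝔼[(p_r^k)² s_r^k]`. -/
def sqWork (R : FedRun d ι Ξ Ω) (r : ℕ) (k : ι) : ℝ :=
  ∫ ω, R.p r k ω ^ 2 * (R.s r k ω : ℝ) ∂(R.P)

/-- `𝔼[(∑_k p_r^k - 2)_+ ∑_k p_r^k s_r^k]`. -/
def excessWork (R : FedRun d ι Ξ Ω) (A : Finset ι) (r : ℕ) : ℝ :=
  ∫ ω, max (∑ k ∈ A, R.p r k ω - 2) 0 * ∑ k ∈ A, R.p r k ω * (R.s r k ω : ℝ) ∂(R.P)

/-- The participation moments of the devices `A` in the rounds `τ` and `r` agree. -/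
def SameMoments (R : FedRun d ι Ξ Ω) (A : Finset ι) (τ r : ℕ) : Prop :=
  (∀ k ∈ A, R.work τ k = R.work r k) ∧ (∀ k ∈ A, R.sqWork τ k = R.sqWork r k) ∧
    R.excessWork A τ = R.excessWork A r

/-- `γ`. -/
def gam (R : FedRun d ι Ξ Ω) (A : Finset ι) (θ : ℝ) (r : ℕ) : ℝ :=
  max (32 * R.E * (1 + θ) * R.L / (R.μ * R.totalWork A r))
    (4 * (R.E : ℝ) ^ 2 * θ / R.totalWork A r)

open Classical in
/-- `z_r`: zero if `𝔼[p_r^k s_r^k] / p^k` has the same value for all `k`, and one otherwise. -/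
def bias (R : FedRun d ι Ξ Ω) (A : Finset ι) (r : ℕ) : ℝ :=
  if ∃ c : ℝ, ∀ k ∈ A, R.work r k / R.weight A k = c then 0 else 1

/-- `M`: the number of biased rounds among `a, …, b - 1`. -/
def biasCount (R : FedRun d ι Ξ Ω) (A : Finset ι) (a b : ℕ) : ℝ :=
  ∑ t ∈ Finset.Ico a b, R.bias A t

/-- `D`. -/
def driftConst (R : FedRun d ι Ξ Ω) (A : Finset ι) (v : EuclideanSpace ℝ (Fin d)) (r : ℕ) : ℝ :=
  64 * R.E * (∑ k ∈ A, R.work r k * R.gap v k) / (R.μ * R.totalWork A r)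

/-- The random variable `B_r`. -/
def noise (R : FedRun d ι Ξ Ω) (A : Finset ι) (θ : ℝ) (v : EuclideanSpace ℝ (Fin d)) (r : ℕ)
    (ω : Ω) : ℝ :=
  2 * (2 + θ) * R.L * (∑ k ∈ A, R.p r k ω * (R.s r k ω : ℝ) * R.gap v k)
  + (2 + R.μ / (2 * (1 + θ) * R.L)) * R.E * ((R.E : ℝ) - 1) * R.G ^ 2
      * (∑ k ∈ A, R.p r k ω * (R.s r k ω : ℝ)
        + θ * max (∑ k ∈ A, R.p r k ω - 2) 0 * ∑ k ∈ A, R.p r k ω * (R.s r k ω : ℝ))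
  + 2 * R.E * R.G ^ 2 * (∑ k ∈ A, R.p r k ω ^ 2 / R.weight A k * (R.s r k ω : ℝ))
  + ∑ k ∈ A, R.p r k ω ^ 2 * (R.s r k ω : ℝ) * R.σ k ^ 2

/-- `V`, the maximum of a first term `V₁`, which measures the distance at the start of the phase,
and of the noise term. -/
def varConst (R : FedRun d ι Ξ Ω) (A : Finset ι) (θ : ℝ) (v : EuclideanSpace ℝ (Fin d)) (r : ℕ)
    (V₁ : ℝ) : ℝ :=
  max V₁ ((16 * R.E / (R.μ * R.totalWork A r)) ^ 2 * ((∫ ω, R.noise A θ v r ω ∂(R.P)) / R.E))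

/-! The training. -/

/-- Participating devices in round `τ`. -/
def devices (R : FedRun d ι Ξ Ω) (τ : ℕ) : Finset ι :=
  if τ < R.τ₀ then R.C else R.C'

/-- `γ̃`. -/
def gamNew (R : FedRun d ι Ξ Ω) : ℝ := R.gam R.C' R.θ' R.τ₀

/-- `γ` before the shift. -/
def gamOld (R : FedRun d ι Ξ Ω) : ℝ := R.gam R.C R.θ 0

/-- Learning rates: `η₀` before the shift; restarted at round `τ₀`. -/
def rate (R : FedRun d ι Ξ Ω) (τ : ℕ) : ℝ :=
  if τ < R.τ₀ then R.η₀ τ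
  else 16 * R.E / (R.μ * R.totalWork R.C' R.τ₀) * (1 / (((τ : ℝ) - R.τ₀) * R.E + R.gamNew))

/-- `R.global τ` is the global weight at the beginning of round `τ`. Device `k` performs
`s τ k` local steps from it, and the coordinator adds the local changes with the coefficients
`p τ k`. -/
def global (R : FedRun d ι Ξ Ω) : ℕ → Ω → EuclideanSpace ℝ (Fin d)
  | 0 => R.w₀
  | τ + 1 => fun ω => global R τ ω + ∑ k ∈ R.devices τ, R.p τ k ω •
      (localSGD (R.rate τ) (R.grad k) (fun j => R.ξ τ k j ω) (global R τ ω) (R.s τ k ω)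
        - global R τ ω)

/-- The local weight of device `k` after `i` local steps in round `τ`. -/
def localW (R : FedRun d ι Ξ Ω) (τ : ℕ) (k : ι) (i : ℕ) (ω : Ω) : EuclideanSpace ℝ (Fin d) :=
  localSGD (R.rate τ) (R.grad k) (fun j => R.ξ τ k j ω) (R.global τ ω) i

/-- The information carried by each source of randomness. -/
@[reducible] def info (R : FedRun d ι Ξ Ω) : FedSource ι → MeasurableSpace Ω
  | .init => MeasurableSpace.comap R.w₀ inferInstance
  | .part τ => MeasurableSpace.comap (fun ω k => (R.p τ k ω, R.s τ k ω))
      (inferInstance : MeasurableSpace (ι → ℝ × ℕ))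
  | .batch τ k i => MeasurableSpace.comap (R.ξ τ k i) inferInstance

/-- The standing assumptions on the training. -/
structure Assumptions (R : FedRun d ι Ξ Ω) : Prop where
  isProb : IsProbabilityMeasure R.P
  E_pos : 0 < R.E
  /-- there are rounds before and after the shift -/
  τ₀_pos : 0 < R.τ₀
  τ₀_lt : R.τ₀ < R.T
  L_pos : 0 < R.L
  μ_pos : 0 < R.μ
  θ_pos : 0 < R.θ
  θ'_pos : 0 < R.θ'
  n_pos : ∀ k, 0 < R.n k
  shift : R.Arrival ∨ R.Departure
  /-- the local objectives are `L`-smooth -/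
  diff : ∀ k, Differentiable ℝ (R.F k)
  smooth : ∀ k x y, ‖∇ (R.F k) x - ∇ (R.F k) y‖ ≤ R.L * ‖x - y‖
  /-- the local objectives are `μ`-strongly convex -/
  strong : ∀ k, StrongConvexOn Set.univ R.μ (R.F k)
  isMin : ∀ w, R.objective R.C R.wopt ≤ R.objective R.C w
  isMin' : ∀ w, R.objective R.C' R.wopt' ≤ R.objective R.C' w
  w₀_meas : Measurable R.w₀
  w₀_sq : MemLp R.w₀ 2 R.P
  p_meas : ∀ τ k, Measurable (R.p τ k)
  s_meas : ∀ τ k, Measurable (R.s τ k)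
  ξ_meas : ∀ τ k i, Measurable (R.ξ τ k i)
  grad_meas : ∀ k, Measurable (Function.uncurry (R.grad k))
  /-- the initial weight, the participation (joint over the devices) in the different rounds and
  the mini-batches are mutually independent -/
  indep : iIndep R.info R.P
  /-- the mini-batches of a device are sampled from its data -/
  law : ∀ τ < R.T, ∀ k ∈ R.devices τ, ∀ i < R.E, R.P.map (R.ξ τ k i) = R.ν k
  /-- the full gradient is the mean of the stochastic gradient -/
  unbiased : ∀ k w, Integrable (R.grad k w) (R.ν k) ∧ ∫ x, R.grad k w x ∂(R.ν k) = ∇ (R.F k) w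
  /-- variance of the stochastic gradients along the training -/
  variance : ∀ τ < R.T, ∀ k ∈ R.devices τ, ∀ i < R.E,
    ∫⁻ ω, ‖R.grad k (R.localW τ k i ω) (R.ξ τ k i ω) - ∇ (R.F k) (R.localW τ k i ω)‖ₑ ^ 2 ∂(R.P)
      ≤ ENNReal.ofReal (R.σ k ^ 2)
  /-- second moment of the stochastic gradients along the training -/
  secondMoment : ∀ τ < R.T, ∀ k ∈ R.devices τ, ∀ i < R.E,
    ∫⁻ ω, ‖R.grad k (R.localW τ k i ω) (R.ξ τ k i ω)‖ₑ ^ 2 ∂(R.P) ≤ ENNReal.ofReal (R.G ^ 2)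
  s_le : ∀ τ < R.T, ∀ k ∈ R.devices τ, ∀ᵐ ω ∂(R.P), R.s τ k ω ≤ R.E
  p_nonneg : ∀ τ < R.T, ∀ k ∈ R.devices τ, ∀ᵐ ω ∂(R.P), 0 ≤ R.p τ k ω
  /-- bounded aggregation coefficients, before and after the shift -/
  p_le : ∀ τ < R.τ₀, ∀ k ∈ R.C, ∀ᵐ ω ∂(R.P), R.p τ k ω / R.weight R.C k ≤ R.θ
  p_le' : ∀ τ, R.τ₀ ≤ τ → τ < R.T → ∀ k ∈ R.C', ∀ᵐ ω ∂(R.P), R.p τ k ω / R.weight R.C' k ≤ R.θ'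
  /-- within each phase the participation moments do not vary with time -/
  moments : ∀ τ < R.τ₀, R.SameMoments R.C τ 0
  moments' : ∀ τ, R.τ₀ ≤ τ → τ < R.T → R.SameMoments R.C' τ R.τ₀
  work_ne : R.totalWork R.C 0 ≠ 0
  work_ne' : R.totalWork R.C' R.τ₀ ≠ 0

/-! The quantities of the statement. -/

/-- `𝔼‖w_{τE} - v‖²`. -/
def msd (R : FedRun d ι Ξ Ω) (τ : ℕ) (v : EuclideanSpace ℝ (Fin d)) : ℝ :=
  ∫ ω, ‖R.global τ ω - v‖ ^ 2 ∂(R.P)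

/-- `D` before the shift. -/
def DOld (R : FedRun d ι Ξ Ω) : ℝ := R.driftConst R.C R.wopt 0

/-- `V` before the shift. -/
def VOld (R : FedRun d ι Ξ Ω) : ℝ :=
  R.varConst R.C R.θ R.wopt 0 (R.gamOld ^ 2 * R.msd 0 R.wopt)

/-- `D̃`. -/
def DNew (R : FedRun d ι Ξ Ω) : ℝ := R.driftConst R.C' R.wopt' R.τ₀

/-- The first term of `Ṽ`, for a bound `Δ` on the mean square distance at the shift. -/
def VNewFirst (R : FedRun d ι Ξ Ω) (Δ : ℝ) : ℝ :=
  R.gamNew ^ 2 * (√Δ + ‖R.wopt - R.wopt'‖) ^ 2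

/-- `Ṽ`. -/
def VNew (R : FedRun d ι Ξ Ω) (Δ : ℝ) : ℝ :=
  R.varConst R.C' R.θ' R.wopt' R.τ₀ (R.VNewFirst Δ)

end

end FedRun

/-! Both phases obey one theorem, `IsPhase.msd_le`: from a freshly started learning rate, the mean
square distance to the optimum v of the phase is bounded at the rate 1/(iE+γ) after i rounds, up to
a numerator that grows with the number of biased rounds. A round is w ↦ w - ηU, where U sums the
stochastic gradients of a fixed number E of virtual local steps, each multiplied by `coef`, which
vanishes on the steps that are not completed. The participation of the round is independent of the
virtual trajectories, so the coefficients factor out of expectations, and a fresh mini-batch lets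
the full gradient replace the stochastic one (`integral_inner_stochGrad`).

In the cross term of ‖w - v - ηU‖², `inner_gradient_three_point` produces F_k(w) - F_k(v) at the
global weight w, the same for all local steps, at the price of the local drift, whose mean square is
of order η². Weighted with 𝔼[p^k s^k] and summed over k, these differences give a nonnegative
multiple of the global excess in an unbiased round, and at least W' = -∑ 𝔼[p^k s^k] Γ_k in any
other; only here does bias enter. Together with a Cauchy-Schwarz bound for 𝔼‖U‖² this yields m' ≤ (1
- ημS/2) m + 2ηzW + η²𝔼[B] with W = -W', and `sgd_recursion_step` propagates the rate through it.

At the shift, Minkowski's inequality (`integral_norm_sub_sq_le`) passes from the old optimum to the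
new one, which explains the first term of Ṽ. The two optima are compared through the device sets
with and without l: quadratic growth bounds their distance by the gap of l at the optimum without l
(`norm_sub_sq_le_gap_of_cons`), and the size of the gradient of F_l bounds it by the gap at the
optimum with l (`norm_sub_sq_le_gap_of_cons'`). -/

/-! ### Smooth and strongly convex functions. -/

section Objectives

variable {V : Type*} [NormedAddCommGroup V] [InnerProductSpace ℝ V] [CompleteSpace V]

lemma hasDerivAt_comp_line {F : V → ℝ} (hF : Differentiable ℝ F) (x h : V) (t : ℝ) :
    HasDerivAt (fun t : ℝ => F (x + t • h)) (inner ℝ (∇ F (x + t • h)) h) t := by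
  have h1 : HasDerivAt (fun t : ℝ => x + t • h) h t := by
    simpa using ((hasDerivAt_id t).smul_const h).const_add x
  have h2 := (hF (x + t • h)).hasGradientAt.hasFDerivAt
  have h3 := h2.comp_hasDerivAt t h1
  simpa [Function.comp_def] using h3

/-- First-order characterization of strong convexity. -/
lemma StrongConvexOn.add_inner_gradient_le {F : V → ℝ} {m : ℝ} (hs : StrongConvexOn Set.univ m F)
    (hF : Differentiable ℝ F) (x y : V) :
    F x + inner ℝ (∇ F x) (y - x) + m / 2 * ‖y - x‖ ^ 2 ≤ F y := by
  have hd := hasDerivAt_comp_line hF x (y - x) 0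
  have ht := hd.tendsto_slope_zero_right
  simp only [zero_smul, add_zero, zero_add] at ht
  have ht2 : Filter.Tendsto (fun t : ℝ => F y - F x - (1 - t) * (m / 2 * ‖y - x‖ ^ 2))
      (nhdsWithin 0 (Set.Ioi 0)) (nhds (F y - F x - (1 - 0) * (m / 2 * ‖y - x‖ ^ 2))) := by
    apply tendsto_nhdsWithin_of_tendsto_nhds
    apply Continuous.tendsto
    fun_prop
  -- Convexity on the segment from x to y, divided by t, bounds the difference quotient for 0 < t <
  -- 1; then t → 0+.
  have hle := le_of_tendsto_of_tendsto ht ht2 (by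
    filter_upwards [Ioo_mem_nhdsGT (show (0 : ℝ) < 1 by norm_num)] with t ht
    obtain ⟨h0, h1⟩ := ht
    have h := hs.2 (Set.mem_univ y) (Set.mem_univ x) h0.le (sub_nonneg.2 h1.le) (by ring)
    have e : t • y + (1 - t) • x = x + t • (y - x) := by module
    rw [e] at h
    simp only [smul_eq_mul] at h ⊢
    rw [inv_mul_le_iff₀ h0]
    linarith)
  linarith

/-- The descent lemma. -/
lemma le_add_inner_gradient_add {F : V → ℝ} {L : ℝ} (hF : Differentiable ℝ F)
    (hL : ∀ x y, ‖∇ F x - ∇ F y‖ ≤ L * ‖x - y‖) (x y : V) :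
    F y ≤ F x + inner ℝ (∇ F x) (y - x) + L / 2 * ‖y - x‖ ^ 2 := by
  set h := y - x with hh
  -- By Cauchy-Schwarz and the Lipschitz bound the derivative of φ is nonpositive for t > 0; the
  -- claim is φ 1 ≤ φ 0.
  let φ : ℝ → ℝ := fun t =>
    F (x + t • h) - t * inner ℝ (∇ F x) h - t ^ 2 * (L / 2 * ‖h‖ ^ 2)
  have hφ : ∀ t, HasDerivAt φ (inner ℝ (∇ F (x + t • h)) h - inner ℝ (∇ F x) h
      - 2 * t * (L / 2 * ‖h‖ ^ 2)) t := by
    intro t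
    have h1 := (hasDerivAt_id t).mul_const (inner ℝ (∇ F x) h)
    have h2 := (hasDerivAt_pow 2 t).mul_const (L / 2 * ‖h‖ ^ 2)
    have h3 := ((hasDerivAt_comp_line hF x h t).sub h1).sub h2
    exact h3.congr_deriv (by norm_num)
  have hanti : AntitoneOn φ (Set.Icc 0 1) := by
    apply antitoneOn_of_deriv_nonpos (convex_Icc 0 1)
    · exact fun t _ => (hφ t).continuousAt.continuousWithinAt
    · exact fun t _ => (hφ t).differentiableAt.differentiableWithinAt
    · intro t ht
      rw [interior_Icc] at ht
      rw [(hφ t).deriv, ← inner_sub_left]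
      have h1 := real_inner_le_norm (∇ F (x + t • h) - ∇ F x) h
      have h2 := hL (x + t • h) x
      rw [add_sub_cancel_left, norm_smul, Real.norm_of_nonneg ht.1.le] at h2
      have h3 := mul_le_mul_of_nonneg_right h2 (norm_nonneg h)
      nlinarith
  have := hanti (Set.left_mem_Icc.2 zero_le_one) (Set.right_mem_Icc.2 zero_le_one) zero_le_one
  simp only [φ, one_smul, zero_smul, add_zero] at this
  rw [hh, add_sub_cancel] at this
  rw [hh]
  linarith

/-- A differentiable strongly convex function is bounded below. -/
lemma StrongConvexOn.bddBelow_range {F : V → ℝ} {m : ℝ} (hm : 0 < m)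
    (hs : StrongConvexOn Set.univ m F) (hF : Differentiable ℝ F) :
    BddBelow (Set.range F) := by
  -- The minimum over r of the quadratic minorant F 0 - ‖∇ F 0‖ r + (m/2) r², found by completing
  -- the square.
  refine ⟨F 0 - ‖∇ F 0‖ ^ 2 / (2 * m), ?_⟩
  rintro _ ⟨y, rfl⟩
  have h := hs.add_inner_gradient_le hF 0 y
  rw [sub_zero] at h
  have h1 := neg_le_of_abs_le (abs_real_inner_le_norm (∇ F 0) y)
  have h2 : 0 ≤ (m * ‖y‖ - ‖∇ F 0‖) ^ 2 / (2 * m) := by positivity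
  have h3 : (m * ‖y‖ - ‖∇ F 0‖) ^ 2 / (2 * m)
      = m / 2 * ‖y‖ ^ 2 - ‖∇ F 0‖ * ‖y‖ + ‖∇ F 0‖ ^ 2 / (2 * m) := by
    field_simp
    ring
  linarith

/-- A gradient step of length 1/L lowers F by at least ‖∇ F x‖²/(2L), yet cannot go below the
infimum. -/
lemma norm_gradient_sq_le {F : V → ℝ} {L : ℝ} (hL0 : 0 < L) (hF : Differentiable ℝ F)
    (hL : ∀ x y, ‖∇ F x - ∇ F y‖ ≤ L * ‖x - y‖) (hb : BddBelow (Set.range F)) (x : V) :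
    ‖∇ F x‖ ^ 2 ≤ 2 * L * (F x - ⨅ w, F w) := by
  have h := le_add_inner_gradient_add hF hL x (x - L⁻¹ • ∇ F x)
  have h1 := ciInf_le hb (x - L⁻¹ • ∇ F x)
  rw [sub_sub_cancel_left, norm_neg, inner_neg_right, inner_smul_right, norm_smul, mul_pow,
    real_inner_self_eq_norm_sq, Real.norm_of_nonneg (inv_pos.2 hL0).le] at h
  have e : L / 2 * (L⁻¹ ^ 2 * ‖∇ F x‖ ^ 2) = L⁻¹ * ‖∇ F x‖ ^ 2 / 2 := by
    field_simp
  have e2 : ‖∇ F x‖ ^ 2 = 2 * L * (L⁻¹ * ‖∇ F x‖ ^ 2 / 2) := by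
    field_simp
  rw [e2]
  apply mul_le_mul_of_nonneg_left _ (by positivity)
  linarith

/-- Three-point inequality for the gradient at a perturbed point `u` of `w`. -/
lemma inner_gradient_three_point {F : V → ℝ} {L m : ℝ} (hm : 0 ≤ m)
    (hs : StrongConvexOn Set.univ m F) (hF : Differentiable ℝ F)
    (hL : ∀ x y, ‖∇ F x - ∇ F y‖ ≤ L * ‖x - y‖) (u w v : V) :
    2 * (F w - F v) + m / 2 * ‖w - v‖ ^ 2 - (L + m) * ‖u - w‖ ^ 2
      ≤ 2 * inner ℝ (w - v) (∇ F u) := by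
  have h1 := hs.add_inner_gradient_le hF u v
  have h2 := le_add_inner_gradient_add hF hL u w
  have e : inner ℝ (∇ F u) (w - u) - inner ℝ (∇ F u) (v - u) = inner ℝ (w - v) (∇ F u) := by
    rw [← inner_sub_right, real_inner_comm]
    congr 1
    abel
  -- Trades the term m‖v - u‖² of strong convexity for (m/2)‖w - v‖², at the cost of m‖u - w‖²;
  -- hence the constant L + m.
  have h3 : ‖w - v‖ ^ 2 ≤ 2 * ‖u - w‖ ^ 2 + 2 * ‖v - u‖ ^ 2 := by
    have : ‖w - v‖ ≤ ‖u - w‖ + ‖v - u‖ := by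
      have := norm_add_le (w - u) (u - v)
      rw [sub_add_sub_cancel, norm_sub_rev w u, norm_sub_rev u v] at this
      exact this
    have h0 := norm_nonneg (w - v)
    nlinarith [sq_nonneg (‖u - w‖ - ‖v - u‖)]
  rw [norm_sub_rev w u] at h2
  nlinarith

end Objectives

/-- Weighted Cauchy-Schwarz inequality for the squared norm of a sum. -/
lemma norm_sq_sum_le_sum_div {V : Type*} [SeminormedAddCommGroup V]
    {κ : Type*} (s : Finset κ) {a : κ → ℝ} (ha : ∀ k ∈ s, 0 < a k)
    (hs : ∑ k ∈ s, a k = 1) (x : κ → V) :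
    ‖∑ k ∈ s, x k‖ ^ 2 ≤ ∑ k ∈ s, ‖x k‖ ^ 2 / a k := by
  have h1 : ‖∑ k ∈ s, x k‖ ^ 2 ≤ (∑ k ∈ s, ‖x k‖) ^ 2 := by
    gcongr
    exact norm_sum_le _ _
  have h2 := Finset.sum_sq_le_sum_mul_sum_of_sq_le_mul s (r := fun k => ‖x k‖) (f := a)
    (g := fun k => ‖x k‖ ^ 2 / a k) (fun k hk => (ha k hk).le)
    (fun k hk => div_nonneg (sq_nonneg _) (ha k hk).le)
    (fun k hk => by exact (mul_div_cancel₀ _ (ha k hk).ne').ge)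
  rw [hs, one_mul] at h2
  exact h1.trans h2

/-! ### Square-integrable random vectors and independent samples. -/

section Probability

/-- Replacing a random field, evaluated at an independent sample, by its mean. -/
lemma integral_inner_field_of_indepFun {V Ω Ξ : Type*} [NormedAddCommGroup V]
    [InnerProductSpace ℝ V] [CompleteSpace V] [MeasurableSpace V] [BorelSpace V]
    [SecondCountableTopology V] [MeasurableSpace Ω] [MeasurableSpace Ξ] {P : Measure Ω}
    [IsProbabilityMeasure P] {Y Z : Ω → V} {ξ : Ω → Ξ} {g : V → Ξ → V} (hY : Measurable Y)
    (hZ : Measurable Z) (hξ : Measurable ξ)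
    (hind : IndepFun (fun ω => (Y ω, Z ω)) ξ P) (hg : Measurable (Function.uncurry g))
    (hgi : ∀ w, Integrable (g w) (P.map ξ))
    (hint : Integrable (fun ω => inner ℝ (Y ω) (g (Z ω) (ξ ω))) P) :
    Integrable (fun ω => inner ℝ (Y ω) (∫ x, g (Z ω) x ∂(P.map ξ))) P ∧
    ∫ ω, inner ℝ (Y ω) (g (Z ω) (ξ ω)) ∂P
      = ∫ ω, inner ℝ (Y ω) (∫ x, g (Z ω) x ∂(P.map ξ)) ∂P := by
  have hYZ : Measurable fun ω => (Y ω, Z ω) := hY.prodMk hZ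
  have hprod := (indepFun_iff_map_prod_eq_prod_map_map hYZ.aemeasurable hξ.aemeasurable).1 hind
  have : IsProbabilityMeasure (P.map ξ) := Measure.isProbabilityMeasure_map hξ.aemeasurable
  have : IsProbabilityMeasure (P.map fun ω => (Y ω, Z ω)) :=
    Measure.isProbabilityMeasure_map hYZ.aemeasurable
  let f : (V × V) × Ξ → ℝ := fun q => inner ℝ q.1.1 (g q.1.2 q.2)
  have hf : Measurable f :=
    (measurable_fst.comp measurable_fst).inner
      (hg.comp ((measurable_snd.comp measurable_fst).prodMk measurable_snd))
  have hm : Measurable fun ω => ((Y ω, Z ω), ξ ω) := hYZ.prodMk hξ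
  have hfi : Integrable f ((P.map fun ω => (Y ω, Z ω)).prod (P.map ξ)) := by
    rw [← hprod]
    exact (integrable_map_measure hf.aestronglyMeasurable hm.aemeasurable).2 hint
  have hinner : ∀ q : V × V, ∫ x, f (q, x) ∂(P.map ξ)
      = inner ℝ q.1 (∫ x, g q.2 x ∂(P.map ξ)) := fun q => integral_inner (hgi q.2) q.1
  have hl := hfi.integral_prod_left
  simp only [hinner] at hl
  constructor
  · exact (integrable_map_measure hl.1 hYZ.aemeasurable).1 hl
  · have h1 : ∫ ω, inner ℝ (Y ω) (g (Z ω) (ξ ω)) ∂P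
        = ∫ q, f q ∂(P.map fun ω => ((Y ω, Z ω), ξ ω)) :=
      (integral_map hm.aemeasurable hf.aestronglyMeasurable).symm
    -- Independence makes the joint law a product, so Fubini integrates out the sample while Y and Z
    -- stay fixed.
    rw [h1, hprod, integral_prod _ hfi]
    simp only [hinner]
    exact integral_map hYZ.aemeasurable hl.1

lemma integrable_norm_sq_of_memLp {V Ω : Type*} [NormedAddCommGroup V] [MeasurableSpace Ω]
    {P : Measure Ω} {f : Ω → V} (hf : MemLp f 2 P) : Integrable (fun ω => ‖f ω‖ ^ 2) P :=
  (memLp_two_iff_integrable_sq_norm hf.1).1 hf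

lemma integrable_inner_of_memLp {V Ω : Type*} [NormedAddCommGroup V] [InnerProductSpace ℝ V]
    [MeasurableSpace Ω] {P : Measure Ω} {f g : Ω → V} (hf : MemLp f 2 P) (hg : MemLp g 2 P) :
    Integrable (fun ω => inner ℝ (f ω) (g ω)) P := by
  refine ((integrable_norm_sq_of_memLp hf).add (integrable_norm_sq_of_memLp hg)).mono'
    (hf.1.inner hg.1) (Filter.Eventually.of_forall fun ω => ?_)
  have := abs_real_inner_le_norm (f ω) (g ω)
  rw [Real.norm_eq_abs, Pi.add_apply]
  nlinarith [two_mul_le_add_sq ‖f ω‖ ‖g ω‖, norm_nonneg (f ω), norm_nonneg (g ω)]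

lemma eLpNorm_two_sq_eq_lintegral {V Ω : Type*} [NormedAddCommGroup V] [MeasurableSpace Ω]
    {P : Measure Ω} (f : Ω → V) : eLpNorm f 2 P ^ 2 = ∫⁻ ω, ‖f ω‖ₑ ^ 2 ∂P := by
  rw [eLpNorm_eq_lintegral_rpow_enorm_toReal (by norm_num) (by norm_num), ← ENNReal.rpow_natCast,
    ← ENNReal.rpow_mul]
  norm_num

lemma ofReal_integral_norm_sq {V Ω : Type*} [NormedAddCommGroup V] [MeasurableSpace Ω]
    {P : Measure Ω} {f : Ω → V} (hf : MemLp f 2 P) :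
    ENNReal.ofReal (∫ ω, ‖f ω‖ ^ 2 ∂P) = eLpNorm f 2 P ^ 2 := by
  rw [eLpNorm_two_sq_eq_lintegral, ofReal_integral_eq_lintegral_ofReal
    (integrable_norm_sq_of_memLp hf) (Filter.Eventually.of_forall fun ω => by positivity)]
  congr 1 with ω
  rw [ENNReal.ofReal_pow (norm_nonneg _), ofReal_norm]

lemma integral_norm_sq_le_of_eLpNorm_le {V Ω : Type*} [NormedAddCommGroup V] [MeasurableSpace Ω]
    {P : Measure Ω} {f : Ω → V} (hf : AEStronglyMeasurable f P) {c : ℝ} (hc : 0 ≤ c)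
    (h : eLpNorm f 2 P ≤ ENNReal.ofReal c) : MemLp f 2 P ∧ ∫ ω, ‖f ω‖ ^ 2 ∂P ≤ c ^ 2 := by
  have hm : MemLp f 2 P := ⟨hf, h.trans_lt ENNReal.ofReal_lt_top⟩
  refine ⟨hm, ?_⟩
  rw [← ENNReal.ofReal_le_ofReal_iff (sq_nonneg c), ofReal_integral_norm_sq hm,
    ENNReal.ofReal_pow hc]
  gcongr

/-- Minkowski's inequality for a translate by a constant vector. -/
lemma integral_norm_sub_sq_le {V Ω : Type*} [NormedAddCommGroup V] [MeasurableSpace Ω]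
    {P : Measure Ω} [IsProbabilityMeasure P] {f : Ω → V} (hf : MemLp f 2 P) (u v : V) {c : ℝ}
    (h : ∫ ω, ‖f ω - u‖ ^ 2 ∂P ≤ c) :
    ∫ ω, ‖f ω - v‖ ^ 2 ∂P ≤ (√c + ‖u - v‖) ^ 2 := by
  have hu : MemLp (fun ω => f ω - u) 2 P := hf.sub (memLp_const u)
  have h1 : eLpNorm (fun ω => f ω - u) 2 P ≤ ENNReal.ofReal (√c) := by
    have hc : 0 ≤ c := (integral_nonneg fun ω => by positivity).trans h
    have := ENNReal.ofReal_le_ofReal h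
    rw [ofReal_integral_norm_sq hu, ← Real.sq_sqrt hc, ENNReal.ofReal_pow (Real.sqrt_nonneg c)]
      at this
    exact (ENNReal.pow_right_strictMono two_ne_zero).le_iff_le.1 this
  refine (integral_norm_sq_le_of_eLpNorm_le (hf.sub (memLp_const v)).1 (by positivity) ?_).2
  have e : (fun ω => f ω - v) = (fun ω => f ω - u) + fun _ => u - v := by
    ext ω
    simp
  rw [ENNReal.ofReal_add (by positivity) (by positivity)]
  have : eLpNorm (fun ω => f ω - v) 2 P ≤ _ := e ▸ eLpNorm_add_le hu.1
    aestronglyMeasurable_const (by norm_num)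
  refine this.trans (add_le_add h1 ?_)
  rw [eLpNorm_const _ (by norm_num) (NeZero.ne P)]
  simp [ofReal_norm]

end Probability

/-! ### Which sources of randomness the weights depend on. -/

lemma measurable_localSGD {d : ℕ} {Ξ Ω : Type*} [MeasurableSpace Ξ] {m : MeasurableSpace Ω} (η : ℝ)
    {g : EuclideanSpace ℝ (Fin d) → Ξ → EuclideanSpace ℝ (Fin d)}
    (hg : Measurable (Function.uncurry g)) {x : ℕ → Ω → Ξ} {w : Ω → EuclideanSpace ℝ (Fin d)}
    (hw : Measurable[m] w) (i : ℕ) (hx : ∀ j < i, Measurable[m] (x j)) :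
    Measurable[m] fun ω => localSGD η g (fun j => x j ω) (w ω) i := by
  induction i with
  | zero => exact hw
  | succ i ih =>
    have h1 := ih fun j hj => hx j (by omega)
    exact h1.sub ((hg.comp (h1.prodMk (hx i (by omega)))).const_smul η)

lemma localSGD_sub_eq_sum {d : ℕ} {Ξ : Type*} (η : ℝ)
    (g : EuclideanSpace ℝ (Fin d) → Ξ → EuclideanSpace ℝ (Fin d)) (x : ℕ → Ξ)
    (w : EuclideanSpace ℝ (Fin d)) (n : ℕ) :
    localSGD η g x w n - w = -(η • ∑ i ∈ Finset.range n, g (localSGD η g x w i) (x i)) := by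
  induction n with
  | zero => simp [localSGD]
  | succ n ih =>
    rw [Finset.sum_range_succ, smul_add, neg_add, ← ih, localSGD]
    abel

/-- The sources of randomness that precede round `τ`. -/
def FedSource.Before {ι : Type*} (τ : ℕ) : FedSource ι → Prop
  | .init => True
  | .part t => t < τ
  | .batch t _ _ => t < τ

/-- The sources on which the local weight of device `k` after `i` steps of round `τ` depends. -/
def FedSource.upTo {ι : Type*} (τ : ℕ) (k : ι) (i : ℕ) : Set (FedSource ι) :=
  {a | a.Before τ ∨ ∃ j < i, a = .batch τ k j}

namespace FedRun

variable {d : ℕ} {ι Ξ Ω : Type*} [MeasurableSpace Ξ] [MeasurableSpace Ω]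

/-- The information carried jointly by a set of sources. -/
@[reducible] def infoOf (R : FedRun d ι Ξ Ω) (S : Set (FedSource ι)) : MeasurableSpace Ω :=
  ⨆ a ∈ S, R.info a

lemma info_le_infoOf (R : FedRun d ι Ξ Ω) {S : Set (FedSource ι)} {a : FedSource ι} (ha : a ∈ S) :
    R.info a ≤ R.infoOf S :=
  le_biSup R.info ha

lemma infoOf_mono (R : FedRun d ι Ξ Ω) {S S' : Set (FedSource ι)} (h : S ⊆ S') :
    R.infoOf S ≤ R.infoOf S' :=
  biSup_mono h

lemma measurable_batch_infoOf (R : FedRun d ι Ξ Ω) {S : Set (FedSource ι)} {τ : ℕ} {k : ι} {i : ℕ}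
    (h : .batch τ k i ∈ S) : Measurable[R.infoOf S] (R.ξ τ k i) :=
  (comap_measurable (R.ξ τ k i)).mono (R.info_le_infoOf h) le_rfl

lemma measurable_part_infoOf (R : FedRun d ι Ξ Ω) {S : Set (FedSource ι)} {τ : ℕ}
    (h : .part τ ∈ S) (k : ι) : Measurable[R.infoOf S] fun ω => (R.p τ k ω, R.s τ k ω) :=
  ((measurable_pi_apply k).comp (comap_measurable fun ω k => (R.p τ k ω, R.s τ k ω))).mono
    (R.info_le_infoOf h) le_rfl

namespace Assumptions

variable {R : FedRun d ι Ξ Ω}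

lemma info_le (hR : R.Assumptions) (a : FedSource ι) : R.info a ≤ ‹MeasurableSpace Ω› := by
  cases a with
  | init => exact hR.w₀_meas.comap_le
  | part τ =>
    exact (measurable_pi_lambda _ fun k => (hR.p_meas τ k).prodMk (hR.s_meas τ k)).comap_le
  | batch τ k i => exact (hR.ξ_meas τ k i).comap_le

lemma infoOf_le (hR : R.Assumptions) (S : Set (FedSource ι)) :
    R.infoOf S ≤ ‹MeasurableSpace Ω› :=
  iSup₂_le fun a _ => hR.info_le a

lemma indep_infoOf (hR : R.Assumptions) {S S' : Set (FedSource ι)} (h : Disjoint S S') :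
    Indep (R.infoOf S) (R.infoOf S') R.P :=
  indep_iSup_of_disjoint hR.info_le hR.indep h

lemma measurable_global_infoOf (hR : R.Assumptions) (τ : ℕ) :
    Measurable[R.infoOf {a | a.Before τ}] (R.global τ) := by
  induction τ with
  | zero =>
    exact (comap_measurable R.w₀).mono
      (R.info_le_infoOf (a := .init) (S := {a | a.Before 0}) trivial) le_rfl
  | succ τ ih =>
    have hsub : {a : FedSource ι | a.Before τ} ⊆ {a | a.Before (τ + 1)} := by
      intro a ha
      cases a with
      | init => trivial
      | part t => exact Nat.lt_succ_of_lt ha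
      | batch t k i => exact Nat.lt_succ_of_lt ha
    have hw := ih.mono (R.infoOf_mono hsub) le_rfl
    refine hw.add (Finset.measurable_fun_sum _ fun k _ => ?_)
    have hps := R.measurable_part_infoOf (S := {a | a.Before (τ + 1)}) (τ := τ)
      (Nat.lt_succ_self τ) k
    refine (measurable_fst.comp hps).smul (Measurable.sub ?_ hw)
    -- The number of completed steps is random; as it ranges over a countable set, joint
    -- measurability reduces to each fixed number of steps.
    have hj : Measurable[(inferInstance : MeasurableSpace ℕ).prod
        (R.infoOf {a | a.Before (τ + 1)})] fun q : ℕ × Ω =>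
        localSGD (R.rate τ) (R.grad k) (fun j => R.ξ τ k j q.2) (R.global τ q.2) q.1 := by
      refine @measurable_from_prod_countable_right ℕ Ω _ _ (R.infoOf _) _ _ _ _ fun i => ?_
      exact measurable_localSGD _ (hR.grad_meas k) hw i fun j _ =>
        R.measurable_batch_infoOf (Nat.lt_succ_self τ)
    exact hj.comp ((measurable_snd.comp hps).prodMk measurable_id)

lemma measurable_localW_infoOf (hR : R.Assumptions) (τ : ℕ) (k : ι) (i : ℕ) :
    Measurable[R.infoOf (FedSource.upTo τ k i)] (R.localW τ k i) := by
  refine measurable_localSGD _ (hR.grad_meas k) ?_ i fun j hj =>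
    R.measurable_batch_infoOf (Or.inr ⟨j, hj, rfl⟩)
  exact (hR.measurable_global_infoOf τ).mono (R.infoOf_mono fun a ha => Or.inl ha) le_rfl

lemma measurable_global (hR : R.Assumptions) (τ : ℕ) : Measurable (R.global τ) :=
  (hR.measurable_global_infoOf τ).mono (hR.infoOf_le _) le_rfl

lemma measurable_localW (hR : R.Assumptions) (τ : ℕ) (k : ι) (i : ℕ) :
    Measurable (R.localW τ k i) :=
  (hR.measurable_localW_infoOf τ k i).mono (hR.infoOf_le _) le_rfl

end Assumptions

/-! ### Moments and independence of the local steps. -/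

/-- The stochastic gradient of device `k` in step `i` of round `τ`. -/
noncomputable def stochGrad (R : FedRun d ι Ξ Ω) (τ : ℕ) (k : ι) (i : ℕ) (ω : Ω) : EuclideanSpace ℝ (Fin d) :=
  R.grad k (R.localW τ k i ω) (R.ξ τ k i ω)

/-- The coefficient of the stochastic gradient of step `i` in the global update: `p` if the step
is completed, and zero otherwise. -/
noncomputable def coef (R : FedRun d ι Ξ Ω) (τ : ℕ) (k : ι) (i : ℕ) (ω : Ω) : ℝ :=
  if i < R.s τ k ω then R.p τ k ω else 0

lemma localW_succ (R : FedRun d ι Ξ Ω) (τ : ℕ) (k : ι) (i : ℕ) (ω : Ω) :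
    R.localW τ k (i + 1) ω = R.localW τ k i ω - R.rate τ • R.stochGrad τ k i ω := rfl

lemma measurable_coef_infoOf (R : FedRun d ι Ξ Ω) (τ : ℕ) (k : ι) (i : ℕ) :
    Measurable[R.infoOf {.part τ}] (R.coef τ k i) := by
  have hφ : Measurable fun q : ℝ × ℕ => if i < q.2 then q.1 else 0 :=
    Measurable.ite (measurableSet_lt measurable_const measurable_snd) measurable_fst
      measurable_const
  exact Measurable.comp hφ (R.measurable_part_infoOf (Set.mem_singleton _) k)

/-- The powers m = 1, 2 lead to `work` and `sqWork`. For m = 0 the steps that are not completed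
would contribute 0 ^ 0 = 1. -/
lemma sum_coef_pow (R : FedRun d ι Ξ Ω) {τ : ℕ} {k : ι} {ω : Ω} {m n : ℕ} (hm : m ≠ 0)
    (h : R.s τ k ω ≤ n) :
    ∑ i ∈ Finset.range n, R.coef τ k i ω ^ m = R.p τ k ω ^ m * R.s τ k ω := by
  simp only [coef, ite_pow, zero_pow hm]
  rw [← Finset.sum_filter, Finset.sum_const, nsmul_eq_mul, mul_comm]
  congr 2
  have : (Finset.range n).filter (fun i => i < R.s τ k ω) = Finset.range (R.s τ k ω) := by
    ext i
    simp only [Finset.mem_filter, Finset.mem_range]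
    omega
  rw [this, Finset.card_range]

namespace Assumptions

variable {R : FedRun d ι Ξ Ω}

lemma weight_pos (hR : R.Assumptions) {A : Finset ι} {k : ι} (hk : k ∈ A) : 0 < R.weight A k := by
  have h : ∀ j, (0 : ℝ) < R.n j := fun j => Nat.cast_pos.2 (hR.n_pos j)
  exact div_pos (h k) (Finset.sum_pos (fun j _ => h j) ⟨k, hk⟩)

lemma sum_weight (hR : R.Assumptions) {A : Finset ι} (hA : A.Nonempty) :
    ∑ k ∈ A, R.weight A k = 1 := by
  have h : (0 : ℝ) < ∑ j ∈ A, (R.n j : ℝ) :=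
    Finset.sum_pos (fun j _ => Nat.cast_pos.2 (hR.n_pos j)) hA
  simp only [weight]
  rw [← Finset.sum_div, div_self h.ne']

lemma exists_p_le (hR : R.Assumptions) {τ : ℕ} (hτ : τ < R.T) {k : ι} (hk : k ∈ R.devices τ) :
    ∃ B : ℝ, ∀ᵐ ω ∂(R.P), R.p τ k ω ≤ B := by
  by_cases h : τ < R.τ₀
  · rw [devices, if_pos h] at hk
    refine ⟨R.θ * R.weight R.C k, ?_⟩
    filter_upwards [hR.p_le τ h k hk] with ω hω using (div_le_iff₀ (hR.weight_pos hk)).1 hω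
  · rw [devices, if_neg h] at hk
    refine ⟨R.θ' * R.weight R.C' k, ?_⟩
    filter_upwards [hR.p_le' τ (not_lt.1 h) hτ k hk] with ω hω
      using (div_le_iff₀ (hR.weight_pos hk)).1 hω

lemma measurable_coef (hR : R.Assumptions) (τ : ℕ) (k : ι) (i : ℕ) : Measurable (R.coef τ k i) :=
  (R.measurable_coef_infoOf τ k i).mono (hR.infoOf_le _) le_rfl

lemma measurable_stochGrad_infoOf (hR : R.Assumptions) (τ : ℕ) (k : ι) (i : ℕ) :
    Measurable[R.infoOf (FedSource.upTo τ k (i + 1))] (R.stochGrad τ k i) := by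
  have h1 : FedSource.upTo τ k i ⊆ FedSource.upTo τ k (i + 1) := by
    rintro a (ha | ⟨j, hj, rfl⟩)
    · exact Or.inl ha
    · exact Or.inr ⟨j, by omega, rfl⟩
  exact (hR.grad_meas k).comp
    (((hR.measurable_localW_infoOf τ k i).mono (R.infoOf_mono h1) le_rfl).prodMk
      (R.measurable_batch_infoOf (Or.inr ⟨i, by omega, rfl⟩)))

lemma measurable_stochGrad (hR : R.Assumptions) (τ : ℕ) (k : ι) (i : ℕ) :
    Measurable (R.stochGrad τ k i) :=
  (hR.measurable_stochGrad_infoOf τ k i).mono (hR.infoOf_le _) le_rfl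

lemma coef_bounds (hR : R.Assumptions) {τ : ℕ} (hτ : τ < R.T) {k : ι} (hk : k ∈ R.devices τ) :
    ∃ B : ℝ, ∀ᵐ ω ∂(R.P), ∀ i, 0 ≤ R.coef τ k i ω ∧ R.coef τ k i ω ≤ B := by
  obtain ⟨B, hB⟩ := hR.exists_p_le hτ hk
  refine ⟨B, ?_⟩
  filter_upwards [hB, hR.p_nonneg τ hτ k hk] with ω h1 h0 i
  rw [coef]
  split_ifs
  · exact ⟨h0, h1⟩
  · exact ⟨le_rfl, h0.trans h1⟩

lemma memLp_top_coef (hR : R.Assumptions) {τ : ℕ} (hτ : τ < R.T) {k : ι} (hk : k ∈ R.devices τ)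
    (i : ℕ) : MemLp (R.coef τ k i) ∞ R.P := by
  obtain ⟨B, hB⟩ := hR.coef_bounds hτ hk
  refine memLp_top_of_bound (hR.measurable_coef τ k i).aestronglyMeasurable B ?_
  filter_upwards [hB] with ω hω
  rw [Real.norm_of_nonneg (hω i).1]
  exact (hω i).2

lemma memLp_top_p (hR : R.Assumptions) {τ : ℕ} (hτ : τ < R.T) {k : ι} (hk : k ∈ R.devices τ) :
    MemLp (R.p τ k) ∞ R.P := by
  obtain ⟨B, hB⟩ := hR.exists_p_le hτ hk
  refine memLp_top_of_bound (hR.p_meas τ k).aestronglyMeasurable B ?_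
  filter_upwards [hB, hR.p_nonneg τ hτ k hk] with ω h1 h0
  rwa [Real.norm_of_nonneg h0]

lemma memLp_top_s (hR : R.Assumptions) {τ : ℕ} (hτ : τ < R.T) {k : ι} (hk : k ∈ R.devices τ) :
    MemLp (fun ω => (R.s τ k ω : ℝ)) ∞ R.P := by
  refine memLp_top_of_bound
    (measurable_from_nat.comp (hR.s_meas τ k)).aestronglyMeasurable (R.E : ℝ) ?_
  filter_upwards [hR.s_le τ hτ k hk] with ω h1
  rw [Real.norm_of_nonneg (Nat.cast_nonneg _)]
  exact_mod_cast h1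

lemma memLp_top_pow_mul (hR : R.Assumptions) {τ : ℕ} (hτ : τ < R.T) {k : ι}
    (hk : k ∈ R.devices τ) :
    MemLp (fun ω => R.p τ k ω * (R.s τ k ω : ℝ)) ∞ R.P ∧
    MemLp (fun ω => R.p τ k ω ^ 2 * (R.s τ k ω : ℝ)) ∞ R.P := by
  have hp := hR.memLp_top_p hτ hk
  have h1 : MemLp (fun ω => R.p τ k ω * (R.s τ k ω : ℝ)) ∞ R.P :=
    (hR.memLp_top_s hτ hk).mul hp
  have h2 : MemLp (fun ω => R.p τ k ω * (R.p τ k ω * (R.s τ k ω : ℝ))) ∞ R.P := h1.mul hp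
  refine ⟨h1, ?_⟩
  convert h2 using 2
  ring

lemma work_nonneg (hR : R.Assumptions) {τ : ℕ} (hτ : τ < R.T) {k : ι} (hk : k ∈ R.devices τ) :
    0 ≤ R.work τ k := by
  refine integral_nonneg_of_ae ?_
  filter_upwards [hR.p_nonneg τ hτ k hk] with ω h0 using mul_nonneg h0 (Nat.cast_nonneg _)

lemma totalWork_eq_sum (hR : R.Assumptions) {τ : ℕ} (hτ : τ < R.T) :
    R.totalWork (R.devices τ) τ = ∑ k ∈ R.devices τ, R.work τ k := by
  have := hR.isProb
  exact integral_finsetSum _ fun k hk => (hR.memLp_top_pow_mul hτ hk).1.integrable le_top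

lemma sum_integral_coef (hR : R.Assumptions) {τ : ℕ} (hτ : τ < R.T) {k : ι}
    (hk : k ∈ R.devices τ) :
    ∑ i ∈ Finset.range R.E, ∫ ω, R.coef τ k i ω ∂(R.P) = R.work τ k := by
  have := hR.isProb
  rw [← integral_finsetSum _ fun i _ => (hR.memLp_top_coef hτ hk i).integrable le_top]
  refine integral_congr_ae ?_
  filter_upwards [hR.s_le τ hτ k hk] with ω hω
  simpa using R.sum_coef_pow one_ne_zero hω

lemma sum_integral_coef_sq (hR : R.Assumptions) {τ : ℕ} (hτ : τ < R.T) {k : ι}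
    (hk : k ∈ R.devices τ) :
    ∑ i ∈ Finset.range R.E, ∫ ω, R.coef τ k i ω ^ 2 ∂(R.P) = R.sqWork τ k := by
  have := hR.isProb
  rw [← integral_finsetSum _ fun i _ =>
    ((hR.memLp_top_coef hτ hk i).mono_exponent le_top).integrable_sq]
  refine integral_congr_ae ?_
  filter_upwards [hR.s_le τ hτ k hk] with ω hω
  exact R.sum_coef_pow two_ne_zero hω

lemma eLpNorm_stochGrad_le (hR : R.Assumptions) {τ : ℕ} (hτ : τ < R.T) {k : ι}
    (hk : k ∈ R.devices τ) {i : ℕ} (hi : i < R.E) :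
    eLpNorm (R.stochGrad τ k i) 2 R.P ≤ ENNReal.ofReal |R.G| := by
  refine (ENNReal.pow_right_strictMono two_ne_zero).le_iff_le.1 ?_
  rw [eLpNorm_two_sq_eq_lintegral, ← ENNReal.ofReal_pow (abs_nonneg _), sq_abs]
  exact hR.secondMoment τ hτ k hk i hi

lemma memLp_stochGrad (hR : R.Assumptions) {τ : ℕ} (hτ : τ < R.T) {k : ι}
    (hk : k ∈ R.devices τ) {i : ℕ} (hi : i < R.E) :
    MemLp (R.stochGrad τ k i) 2 R.P ∧ ∫ ω, ‖R.stochGrad τ k i ω‖ ^ 2 ∂(R.P) ≤ R.G ^ 2 := by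
  rw [← sq_abs R.G]
  exact integral_norm_sq_le_of_eLpNorm_le (hR.measurable_stochGrad τ k i).aestronglyMeasurable
    (abs_nonneg _) (hR.eLpNorm_stochGrad_le hτ hk hi)

/-- The local weights drift at most linearly from the global weight. -/
lemma memLp_localW_sub_global (hR : R.Assumptions) {τ : ℕ} (hτ : τ < R.T) {k : ι}
    (hk : k ∈ R.devices τ) {i : ℕ} (hi : i ≤ R.E) :
    MemLp (fun ω => R.localW τ k i ω - R.global τ ω) 2 R.P ∧
    ∫ ω, ‖R.localW τ k i ω - R.global τ ω‖ ^ 2 ∂(R.P) ≤ (i * (|R.rate τ| * |R.G|)) ^ 2 := by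
  have hm : ∀ i, AEStronglyMeasurable (fun ω => R.localW τ k i ω - R.global τ ω) R.P := fun i =>
    ((hR.measurable_localW τ k i).sub (hR.measurable_global τ)).aestronglyMeasurable
  refine integral_norm_sq_le_of_eLpNorm_le (hm i) (by positivity) ?_
  induction i with
  | zero => simp [localW, localSGD]
  | succ i ih =>
    -- By Minkowski, each step adds at most |η||G| to the L² norm. The absolute value is needed
    -- because only G² is a bound, and G has no sign.
    have e : (fun ω => R.localW τ k (i + 1) ω - R.global τ ω)
        = (fun ω => R.localW τ k i ω - R.global τ ω) - R.rate τ • R.stochGrad τ k i := by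
      ext1 ω
      simp only [Pi.sub_apply, Pi.smul_apply, R.localW_succ]
      abel
    rw [e]
    refine (eLpNorm_sub_le (hm i)
      ((hR.measurable_stochGrad τ k i).const_smul _).aestronglyMeasurable (by norm_num)).trans ?_
    rw [eLpNorm_const_smul, Nat.cast_succ, add_mul, one_mul,
      ENNReal.ofReal_add (by positivity) (by positivity)]
    refine add_le_add (ih (by omega)) ?_
    rw [ENNReal.ofReal_mul (abs_nonneg _), ← Real.norm_eq_abs (R.rate τ), ofReal_norm]
    gcongr
    exact hR.eLpNorm_stochGrad_le hτ hk (by omega)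

/-- Exchanges the random number of steps for a deterministic range with random coefficients, so that
expectations can be taken step by step. Only almost sure, since s ≤ E is. -/
lemma global_succ_ae (hR : R.Assumptions) {τ : ℕ} (hτ : τ < R.T) :
    ∀ᵐ ω ∂(R.P), R.global (τ + 1) ω = R.global τ ω - R.rate τ • ∑ k ∈ R.devices τ,
      ∑ i ∈ Finset.range R.E, R.coef τ k i ω • R.stochGrad τ k i ω := by
  have h : ∀ᵐ ω ∂(R.P), ∀ k ∈ R.devices τ, R.s τ k ω ≤ R.E :=
    (Finset.eventually_all _).2 (hR.s_le τ hτ)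
  filter_upwards [h] with ω hω
  suffices key : ∀ k ∈ R.devices τ, R.p τ k ω •
      (localSGD (R.rate τ) (R.grad k) (fun j => R.ξ τ k j ω) (R.global τ ω) (R.s τ k ω)
        - R.global τ ω)
      = -(R.rate τ • ∑ i ∈ Finset.range R.E, R.coef τ k i ω • R.stochGrad τ k i ω) by
    rw [global]
    beta_reduce
    rw [Finset.sum_congr rfl key, Finset.sum_neg_distrib, ← Finset.smul_sum,
      ← sub_eq_add_neg]
  intro k hk
  rw [localSGD_sub_eq_sum, smul_neg, smul_comm]
  congr 2
  rw [Finset.smul_sum]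
  have e : ∀ i, R.coef τ k i ω • R.stochGrad τ k i ω
      = if i < R.s τ k ω then R.p τ k ω • R.stochGrad τ k i ω else 0 := fun i => by
    rw [coef, ite_smul, zero_smul]
  simp only [e]
  rw [← Finset.sum_filter]
  refine Finset.sum_congr (Finset.ext fun i => ?_) fun i _ => rfl
  have := hω k hk
  simp only [Finset.mem_filter, Finset.mem_range]
  omega

lemma memLp_coef_smul (hR : R.Assumptions) {τ : ℕ} (hτ : τ < R.T) {k : ι}
    (hk : k ∈ R.devices τ) {i : ℕ} (hi : i < R.E) :
    MemLp (fun ω => R.coef τ k i ω • R.stochGrad τ k i ω) 2 R.P :=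
  (hR.memLp_stochGrad hτ hk hi).1.smul (hR.memLp_top_coef hτ hk i)

lemma memLp_global (hR : R.Assumptions) {τ : ℕ} (hτ : τ ≤ R.T) : MemLp (R.global τ) 2 R.P := by
  induction τ with
  | zero => exact hR.w₀_sq
  | succ τ ih =>
    have h : MemLp (fun ω => R.global τ ω - R.rate τ • ∑ k ∈ R.devices τ,
        ∑ i ∈ Finset.range R.E, R.coef τ k i ω • R.stochGrad τ k i ω) 2 R.P := by
      have hs : MemLp (fun ω => ∑ k ∈ R.devices τ,
          ∑ i ∈ Finset.range R.E, R.coef τ k i ω • R.stochGrad τ k i ω) 2 R.P :=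
        memLp_finsetSum _ fun k hk => memLp_finsetSum _ fun i hi =>
          hR.memLp_coef_smul hτ hk (Finset.mem_range.1 hi)
      exact (ih (by omega)).sub (hs.const_smul (R.rate τ))
    exact (memLp_congr_ae (hR.global_succ_ae hτ)).2 h

lemma memLp_global_sub (hR : R.Assumptions) {τ : ℕ} (hτ : τ ≤ R.T)
    (v : EuclideanSpace ℝ (Fin d)) : MemLp (fun ω => R.global τ ω - v) 2 R.P := by
  have := hR.isProb
  exact (hR.memLp_global hτ).sub (memLp_const v)

/-- The virtual trajectory continues whether or not the device completes its steps, so it involves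
earlier rounds and its own mini-batches, but never the participation of the current round. -/
lemma indep_part_upTo (hR : R.Assumptions) (τ : ℕ) (k : ι) (i : ℕ) :
    Indep (R.infoOf {.part τ}) (R.infoOf (FedSource.upTo τ k i)) R.P := by
  refine hR.indep_infoOf (Set.disjoint_singleton_left.2 ?_)
  rintro (h | ⟨j, _, h⟩)
  · exact lt_irrefl _ h
  · cases h

lemma indep_upTo_batch (hR : R.Assumptions) (τ : ℕ) (k : ι) (i : ℕ) :
    Indep (R.infoOf (FedSource.upTo τ k i)) (R.infoOf {.batch τ k i}) R.P := by
  refine hR.indep_infoOf (Set.disjoint_singleton_right.2 ?_)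
  rintro (h | ⟨j, hj, h⟩)
  · exact lt_irrefl _ h
  · cases h
    exact lt_irrefl _ hj

lemma indepFun_coef (hR : R.Assumptions) {τ : ℕ} {k : ι} {i j : ℕ} {φ : ℝ → ℝ}
    (hφ : Measurable φ) {Y : Ω → ℝ} (hY : Measurable[R.infoOf (FedSource.upTo τ k j)] Y) :
    IndepFun (fun ω => φ (R.coef τ k i ω)) Y R.P := by
  rw [IndepFun_iff_Indep]
  exact indep_of_indep_of_le_left (indep_of_indep_of_le_right (hR.indep_part_upTo τ k j)
    hY.comap_le) (hφ.comp (R.measurable_coef_infoOf τ k i)).comap_le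

lemma measurable_global_upTo (hR : R.Assumptions) (τ : ℕ) (k : ι) (i : ℕ) :
    Measurable[R.infoOf (FedSource.upTo τ k i)] (R.global τ) :=
  (hR.measurable_global_infoOf τ).mono (R.infoOf_mono fun _ ha => Or.inl ha) le_rfl

/-- In the mean, a stochastic gradient acts as the full gradient. -/
lemma integral_inner_stochGrad (hR : R.Assumptions) {τ : ℕ} (hτ : τ < R.T) {k : ι}
    (hk : k ∈ R.devices τ) {i : ℕ} (hi : i < R.E) (v : EuclideanSpace ℝ (Fin d)) :
    Integrable (fun ω => inner ℝ (R.global τ ω - v) (∇ (R.F k) (R.localW τ k i ω))) R.P ∧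
    ∫ ω, inner ℝ (R.global τ ω - v) (R.stochGrad τ k i ω) ∂(R.P)
      = ∫ ω, inner ℝ (R.global τ ω - v) (∇ (R.F k) (R.localW τ k i ω)) ∂(R.P) := by
  have := hR.isProb
  have hlaw := hR.law τ hτ k hk i hi
  have hind : IndepFun (fun ω => (R.global τ ω - v, R.localW τ k i ω)) (R.ξ τ k i) R.P := by
    rw [IndepFun_iff_Indep]
    refine indep_of_indep_of_le_left (indep_of_indep_of_le_right (hR.indep_upTo_batch τ k i)
      (R.measurable_batch_infoOf (Set.mem_singleton _)).comap_le) ?_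
    exact (((hR.measurable_global_upTo τ k i).sub_const v).prodMk
      (hR.measurable_localW_infoOf τ k i)).comap_le
  have h := integral_inner_field_of_indepFun ((hR.measurable_global τ).sub_const v)
    (hR.measurable_localW τ k i) (hR.ξ_meas τ k i) hind (hR.grad_meas k)
    (fun w => hlaw ▸ (hR.unbiased k w).1)
    (integrable_inner_of_memLp (hR.memLp_global_sub hτ.le v) (hR.memLp_stochGrad hτ hk hi).1)
  rw [hlaw] at h
  simp only [(hR.unbiased k _).2] at h
  exact h

end Assumptions

/-! ### The expected change of the squared distance in one round. -/

/-- `𝔼[F_k(w_{τE}) - F_k(v)]`. -/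
noncomputable def meanExcess (R : FedRun d ι Ξ Ω) (τ : ℕ) (v : EuclideanSpace ℝ (Fin d)) (k : ι) :
    ℝ :=
  ∫ ω, (R.F k (R.global τ ω) - R.F k v) ∂(R.P)

namespace Assumptions

variable {R : FedRun d ι Ξ Ω}

/-- Strong convexity and smoothness at v enclose the excess between an affine and a quadratic
function of the square-integrable vector w - v. -/
lemma integrable_excess (hR : R.Assumptions) {τ : ℕ} (hτ : τ ≤ R.T)
    (v : EuclideanSpace ℝ (Fin d)) (k : ι) :
    Integrable (fun ω => R.F k (R.global τ ω) - R.F k v) R.P := by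
  have hg := hR.memLp_global_sub hτ v
  have := hR.isProb
  have hi : Integrable (fun ω => inner ℝ (∇ (R.F k) v) (R.global τ ω - v)) R.P :=
    (hg.integrable (by norm_num)).const_inner _
  refine (hi.norm.add ((integrable_norm_sq_of_memLp hg).const_mul (R.L / 2))).mono'
    (((hR.diff k).continuous.measurable.comp (hR.measurable_global τ)).sub_const
      _).aestronglyMeasurable (Filter.Eventually.of_forall fun ω => ?_)
  have h1 := (hR.strong k).add_inner_gradient_le (hR.diff k) v (R.global τ ω)
  have h2 := le_add_inner_gradient_add (hR.diff k) (hR.smooth k) v (R.global τ ω)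
  have hμ := hR.μ_pos
  have hL := hR.L_pos
  have h3 : 0 ≤ R.μ / 2 * ‖R.global τ ω - v‖ ^ 2 := by positivity
  have h4 : 0 ≤ R.L / 2 * ‖R.global τ ω - v‖ ^ 2 := by positivity
  have h5 := le_abs_self (inner ℝ (∇ (R.F k) v) (R.global τ ω - v))
  have h6 := neg_abs_le (inner ℝ (∇ (R.F k) v) (R.global τ ω - v))
  simp only [Pi.add_apply, Real.norm_eq_abs]
  rw [abs_le]
  constructor <;> linarith

lemma integrable_coef_mul_inner (hR : R.Assumptions) {τ : ℕ} (hτ : τ < R.T) {k : ι}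
    (hk : k ∈ R.devices τ) {i : ℕ} (hi : i < R.E) (v : EuclideanSpace ℝ (Fin d)) :
    Integrable (fun ω => R.coef τ k i ω * inner ℝ (R.global τ ω - v) (R.stochGrad τ k i ω))
      R.P := by
  simp only [← real_inner_smul_right]
  exact integrable_inner_of_memLp (hR.memLp_global_sub hτ.le v) (hR.memLp_coef_smul hτ hk hi)

/-- Expected progress of a single local step. -/
lemma le_integral_coef_mul_inner (hR : R.Assumptions) {τ : ℕ} (hτ : τ < R.T) {k : ι}
    (hk : k ∈ R.devices τ) {i : ℕ} (hi : i < R.E) (v : EuclideanSpace ℝ (Fin d)) :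
    (∫ ω, R.coef τ k i ω ∂(R.P)) * (2 * R.meanExcess τ v k + R.μ / 2 * R.msd τ v
        - (R.L + R.μ) * (R.rate τ ^ 2 * (R.E * ((R.E : ℝ) - 1) * R.G ^ 2)))
      ≤ 2 * ∫ ω, R.coef τ k i ω * inner ℝ (R.global τ ω - v) (R.stochGrad τ k i ω) ∂(R.P) := by
  have hμ := hR.μ_pos
  have hL := hR.L_pos
  -- The index is i + 1 because the gradient of step i also uses mini-batch i.
  have hY : Measurable[R.infoOf (FedSource.upTo τ k (i + 1))] fun ω =>
      inner ℝ (R.global τ ω - v) (R.stochGrad τ k i ω) :=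
    ((hR.measurable_global_upTo τ k (i + 1)).sub_const v).inner
      (hR.measurable_stochGrad_infoOf τ k i)
  have hind := hR.indepFun_coef (i := i) measurable_id hY
  simp only [id] at hind
  rw [hind.integral_fun_mul_eq_mul_integral (hR.measurable_coef τ k i).aestronglyMeasurable
    (hY.mono (hR.infoOf_le _) le_rfl).aestronglyMeasurable, mul_left_comm (2 : ℝ)]
  refine mul_le_mul_of_nonneg_left ?_ ?_
  · obtain ⟨hint, hmean⟩ := hR.integral_inner_stochGrad hτ hk hi v
    obtain ⟨hd, hdle⟩ := hR.memLp_localW_sub_global hτ hk hi.le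
    rw [hmean, ← integral_const_mul]
    have hi1 := (hR.integrable_excess hτ.le v k).const_mul 2
    have hi2 := (integrable_norm_sq_of_memLp (hR.memLp_global_sub hτ.le v)).const_mul (R.μ / 2)
    have hi3 := (integrable_norm_sq_of_memLp hd).const_mul (R.L + R.μ)
    have h := integral_mono ((hi1.add hi2).sub hi3) (hint.const_mul 2) fun ω =>
      inner_gradient_three_point hμ.le (hR.strong k) (hR.diff k) (hR.smooth k)
        (R.localW τ k i ω) (R.global τ ω) v
    rw [integral_sub' (hi1.add hi2) hi3, integral_add' hi1 hi2, integral_const_mul,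
      integral_const_mul, integral_const_mul] at h
    refine le_trans (sub_le_sub_left (mul_le_mul_of_nonneg_left (hdle.trans ?_)
      (by positivity)) _) h
    rw [mul_pow, mul_pow, sq_abs, sq_abs]
    -- Only steps i ≤ E - 1 take a gradient, so i² ≤ E(E - 1); this is the factor E(E - 1) in B.
    have hiE : (i : ℝ) ≤ R.E - 1 := by
      rw [le_sub_iff_add_le]
      exact_mod_cast hi
    have hi0 : (0 : ℝ) ≤ i := Nat.cast_nonneg i
    have : (i : ℝ) ^ 2 ≤ R.E * ((R.E : ℝ) - 1) := by nlinarith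
    calc (i : ℝ) ^ 2 * (R.rate τ ^ 2 * R.G ^ 2)
        ≤ (R.E * ((R.E : ℝ) - 1)) * (R.rate τ ^ 2 * R.G ^ 2) := by gcongr
      _ = _ := by ring
  · obtain ⟨B, hB⟩ := hR.coef_bounds hτ hk
    refine integral_nonneg_of_ae ?_
    filter_upwards [hB] with ω hω using (hω i).1

/-- Expected square of the global update. -/
lemma integral_norm_sq_update_le (hR : R.Assumptions) {τ : ℕ} (hτ : τ < R.T)
    (hA : (R.devices τ).Nonempty) :
    ∫ ω, ‖∑ k ∈ R.devices τ, ∑ i ∈ Finset.range R.E, R.coef τ k i ω • R.stochGrad τ k i ω‖ ^ 2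
        ∂(R.P)
      ≤ R.E * R.G ^ 2 * ∑ k ∈ R.devices τ, R.sqWork τ k / R.weight (R.devices τ) k := by
  have hpt : ∀ ω, ‖∑ k ∈ R.devices τ, ∑ i ∈ Finset.range R.E,
      R.coef τ k i ω • R.stochGrad τ k i ω‖ ^ 2
      ≤ ∑ k ∈ R.devices τ, ∑ i ∈ Finset.range R.E, R.E / R.weight (R.devices τ) k *
        ‖R.coef τ k i ω • R.stochGrad τ k i ω‖ ^ 2 := by
    intro ω
    -- Cauchy-Schwarz twice: over devices with weights p^k, which gives the divisor p^k, and over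
    -- the steps of a device, which gives the factor E.
    refine (norm_sq_sum_le_sum_div _ (fun k hk => hR.weight_pos hk) (hR.sum_weight hA) _).trans ?_
    refine Finset.sum_le_sum fun k hk => ?_
    have hw := hR.weight_pos hk
    rw [← Finset.mul_sum, div_mul_eq_mul_div]
    gcongr
    calc ‖∑ i ∈ Finset.range R.E, R.coef τ k i ω • R.stochGrad τ k i ω‖ ^ 2
        ≤ (∑ i ∈ Finset.range R.E, ‖R.coef τ k i ω • R.stochGrad τ k i ω‖) ^ 2 := by
          gcongr
          exact norm_sum_le _ _
      _ ≤ _ := by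
          simpa using sq_sum_le_card_mul_sum_sq (s := Finset.range R.E)
            (f := fun i => ‖R.coef τ k i ω • R.stochGrad τ k i ω‖)
  have hint : ∀ k ∈ R.devices τ, ∀ i ∈ Finset.range R.E, Integrable (fun ω =>
      R.E / R.weight (R.devices τ) k * ‖R.coef τ k i ω • R.stochGrad τ k i ω‖ ^ 2) R.P :=
    fun k hk i hi => (integrable_norm_sq_of_memLp
      (hR.memLp_coef_smul hτ hk (Finset.mem_range.1 hi))).const_mul _
  refine (integral_mono_of_nonneg (Filter.Eventually.of_forall fun ω => by positivity)
    (integrable_finsetSum _ fun k hk => integrable_finsetSum _ fun i hi => hint k hk i hi)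
    (Filter.Eventually.of_forall hpt)).trans ?_
  rw [integral_finsetSum _ fun k hk => integrable_finsetSum _ fun i hi => hint k hk i hi,
    Finset.mul_sum]
  refine Finset.sum_le_sum fun k hk => ?_
  have hw := hR.weight_pos hk
  rw [integral_finsetSum _ (hint k hk), ← hR.sum_integral_coef_sq hτ hk, Finset.sum_div,
    Finset.mul_sum]
  refine Finset.sum_le_sum fun i hi => ?_
  rw [integral_const_mul]
  have hY : Measurable[R.infoOf (FedSource.upTo τ k (i + 1))] fun ω =>
      ‖R.stochGrad τ k i ω‖ ^ 2 :=
    (measurable_norm.pow_const 2).comp (hR.measurable_stochGrad_infoOf τ k i)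
  have hind := hR.indepFun_coef (i := i) (measurable_id.pow_const 2) hY
  simp only [id] at hind
  have e : ∀ ω, ‖R.coef τ k i ω • R.stochGrad τ k i ω‖ ^ 2
      = R.coef τ k i ω ^ 2 * ‖R.stochGrad τ k i ω‖ ^ 2 := fun ω => by
    rw [norm_smul, mul_pow, Real.norm_eq_abs, sq_abs]
  simp only [e]
  rw [hind.integral_fun_mul_eq_mul_integral
    ((hR.measurable_coef τ k i).pow_const 2).aestronglyMeasurable
    (hY.mono (hR.infoOf_le _) le_rfl).aestronglyMeasurable]
  have h1 := (hR.memLp_stochGrad hτ hk (Finset.mem_range.1 hi)).2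
  have h2 : 0 ≤ ∫ ω, R.coef τ k i ω ^ 2 ∂(R.P) := integral_nonneg fun ω => by positivity
  calc R.E / R.weight (R.devices τ) k *
        ((∫ ω, R.coef τ k i ω ^ 2 ∂(R.P)) * ∫ ω, ‖R.stochGrad τ k i ω‖ ^ 2 ∂(R.P))
      ≤ R.E / R.weight (R.devices τ) k * ((∫ ω, R.coef τ k i ω ^ 2 ∂(R.P)) * R.G ^ 2) := by
        gcongr
    _ = _ := by ring

/-- The mean square distance to `v` in one round. -/
lemma msd_succ_le (hR : R.Assumptions) {τ : ℕ} (hτ : τ < R.T) (hA : (R.devices τ).Nonempty)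
    (hη : 0 ≤ R.rate τ) (v : EuclideanSpace ℝ (Fin d)) :
    R.msd (τ + 1) v ≤ R.msd τ v
      - R.rate τ * ∑ k ∈ R.devices τ, R.work τ k * (2 * R.meanExcess τ v k + R.μ / 2 * R.msd τ v
        - (R.L + R.μ) * (R.rate τ ^ 2 * (R.E * ((R.E : ℝ) - 1) * R.G ^ 2)))
      + R.rate τ ^ 2 *
        (R.E * R.G ^ 2 * ∑ k ∈ R.devices τ, R.sqWork τ k / R.weight (R.devices τ) k) := by
  set U : Ω → EuclideanSpace ℝ (Fin d) := fun ω => ∑ k ∈ R.devices τ,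
    ∑ i ∈ Finset.range R.E, R.coef τ k i ω • R.stochGrad τ k i ω with hU
  have hUm : MemLp U 2 R.P := memLp_finsetSum _ fun k hk => memLp_finsetSum _ fun i hi =>
    hR.memLp_coef_smul hτ hk (Finset.mem_range.1 hi)
  have hwm := hR.memLp_global_sub hτ.le v
  have hi1 := integrable_norm_sq_of_memLp hwm
  have hi2 := integrable_inner_of_memLp hwm hUm
  have hi3 := integrable_norm_sq_of_memLp hUm
  have hi4 : Integrable (fun ω => ‖R.global τ ω - v‖ ^ 2
      - R.rate τ * (2 * inner ℝ (R.global τ ω - v) (U ω))) R.P :=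
    hi1.sub ((hi2.const_mul 2).const_mul _)
  have h1 : R.msd (τ + 1) v = R.msd τ v
      - R.rate τ * (2 * ∫ ω, inner ℝ (R.global τ ω - v) (U ω) ∂(R.P))
      + R.rate τ ^ 2 * ∫ ω, ‖U ω‖ ^ 2 ∂(R.P) := by
    rw [msd, msd, ← integral_const_mul, ← integral_const_mul, ← integral_const_mul,
      ← integral_sub hi1 ((hi2.const_mul 2).const_mul _),
      ← integral_add hi4 (hi3.const_mul _)]
    refine integral_congr_ae ?_
    filter_upwards [hR.global_succ_ae hτ] with ω hω
    rw [hω, sub_right_comm, norm_sub_sq_real, inner_smul_right, norm_smul, mul_pow,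
      Real.norm_eq_abs, sq_abs]
    ring
  have h2 : ∫ ω, inner ℝ (R.global τ ω - v) (U ω) ∂(R.P)
      = ∑ k ∈ R.devices τ, ∑ i ∈ Finset.range R.E,
        ∫ ω, R.coef τ k i ω * inner ℝ (R.global τ ω - v) (R.stochGrad τ k i ω) ∂(R.P) := by
    simp only [hU, inner_sum, real_inner_smul_right]
    have hint : ∀ k ∈ R.devices τ, ∀ i ∈ Finset.range R.E, Integrable (fun ω =>
        R.coef τ k i ω * inner ℝ (R.global τ ω - v) (R.stochGrad τ k i ω)) R.P :=
      fun k hk i hi => hR.integrable_coef_mul_inner hτ hk (Finset.mem_range.1 hi) v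
    rw [integral_finsetSum _ fun k hk => integrable_finsetSum _ (hint k hk)]
    exact Finset.sum_congr rfl fun k hk => integral_finsetSum _ (hint k hk)
  rw [h1, h2]
  refine add_le_add (sub_le_sub_left (mul_le_mul_of_nonneg_left ?_ hη) _)
    (mul_le_mul_of_nonneg_left (hR.integral_norm_sq_update_le hτ hA) (sq_nonneg _))
  rw [Finset.mul_sum]
  refine Finset.sum_le_sum fun k hk => ?_
  rw [← hR.sum_integral_coef hτ hk, Finset.sum_mul, Finset.mul_sum]
  exact Finset.sum_le_sum fun i hi =>
    hR.le_integral_coef_mul_inner hτ hk (Finset.mem_range.1 hi) v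

end Assumptions

end FedRun

/-! ### The numerical recursion. -/

/-- One step of the recursion behind the `1 / (τ E + γ)` rate. -/
lemma sgd_recursion_step {e x β q N W D V M z m m' : ℝ} (he : 0 < e) (hx : 4 * e ≤ x) (hβ : 0 < β)
    (hq : β * q = 16 * e) (hW : 0 ≤ W) (hD : D = 4 * β * W) (hM : 0 ≤ M) (hz : 0 ≤ z)
    (hN : 0 ≤ N) (hV : β ^ 2 * (N / e) ≤ V) (hm0 : 0 ≤ m) (hm : m ≤ (M * D + V) / x)
    (h : m' ≤ (1 - β / x * q / 2) * m + 2 * (β / x) * z * W + (β / x) ^ 2 * N) :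
    m' ≤ ((M + z) * D + V) / (x + e) := by
  have hx0 : 0 < x := by linarith
  have hV0 : 0 ≤ V := le_trans (by positivity) hV
  have hD0 : 0 ≤ D := by rw [hD]; positivity
  have hVN : β ^ 2 * N ≤ V * e := by
    rw [← mul_div_assoc, div_le_iff₀ he] at hV
    exact hV
  have e1 : β / x * q = 16 * e / x := by rw [div_mul_eq_mul_div, hq]
  -- The factor equals 1 - 8e/x, which may be negative; it is weakened to 1 - 2e/x ≥ 0 before the
  -- bound on m is inserted.
  have h1 : (1 - β / x * q / 2) * m ≤ (1 - 2 * e / x) * ((M * D + V) / x) := by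
    have hc : 0 ≤ 1 - 2 * e / x := by
      rw [sub_nonneg, div_le_one hx0]
      linarith
    refine le_trans (mul_le_mul_of_nonneg_right ?_ hm0) (mul_le_mul_of_nonneg_left hm hc)
    rw [e1]
    have : 0 ≤ e / x := by positivity
    have e2 : 16 * e / x / 2 = 8 * (e / x) := by ring
    have e3 : 2 * e / x = 2 * (e / x) := by ring
    rw [e2, e3]
    linarith
  have h2 : m' ≤ ((x - 2 * e) * (M * D + V) + x * (z * D) / 2 + V * e) / x ^ 2 := by
    have e4 : 2 * (β / x) * z * W = (x * (z * D) / 2) / x ^ 2 := by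
      rw [hD]
      field_simp
      ring
    have e5 : (1 - 2 * e / x) * ((M * D + V) / x) = ((x - 2 * e) * (M * D + V)) / x ^ 2 := by
      field_simp
    have e6 : (β / x) ^ 2 * N ≤ V * e / x ^ 2 := by
      rw [div_pow, div_mul_eq_mul_div]
      gcongr
    rw [add_div, add_div, ← e4, ← e5]
    linarith
  refine h2.trans ?_
  rw [div_le_div_iff₀ (by positivity) (by positivity)]
  -- With denominators cleared, the right side exceeds the left by MD(ex + 2e²) + Ve² + zD·x(x -
  -- e)/2.
  have hMD : 0 ≤ M * D := mul_nonneg hM hD0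
  have hzD : 0 ≤ z * D := mul_nonneg hz hD0
  have t1 : 0 ≤ M * D * (e * x + 2 * e ^ 2) := by positivity
  have t2 : 0 ≤ V * e ^ 2 := by positivity
  have t3 : 0 ≤ z * D * (x * (x - e)) :=
    mul_nonneg hzD (mul_nonneg hx0.le (by linarith))
  nlinarith

/-! ### Convergence within a phase. -/

namespace FedRun

variable {d : ℕ} {ι Ξ Ω : Type*} [MeasurableSpace Ξ] [MeasurableSpace Ω]

/-- The rounds `a, …, b - 1` are a phase of the training with participating devices `A`,
coefficient bound `θ` and optimum `v`. -/
structure IsPhase (R : FedRun d ι Ξ Ω) (A : Finset ι) (θ : ℝ) (v : EuclideanSpace ℝ (Fin d))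
    (a b : ℕ) : Prop where
  lt : a < b
  le : b ≤ R.T
  devices_eq : ∀ τ, a ≤ τ → τ < b → R.devices τ = A
  θ_pos : 0 < θ
  isMin : ∀ w, R.objective A v ≤ R.objective A w
  p_le : ∀ τ, a ≤ τ → τ < b → ∀ k ∈ A, ∀ᵐ ω ∂(R.P), R.p τ k ω / R.weight A k ≤ θ
  moments : ∀ τ, a ≤ τ → τ < b → R.SameMoments A τ a
  work_ne : R.totalWork A a ≠ 0

namespace Assumptions

variable {R : FedRun d ι Ξ Ω}

lemma isPhase_old (hR : R.Assumptions) : R.IsPhase R.C R.θ R.wopt 0 R.τ₀ where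
  lt := hR.τ₀_pos
  le := hR.τ₀_lt.le
  devices_eq := fun _ _ h => if_pos h
  θ_pos := hR.θ_pos
  isMin := hR.isMin
  p_le := fun τ _ h => hR.p_le τ h
  moments := fun τ _ h => hR.moments τ h
  work_ne := hR.work_ne

lemma isPhase_new (hR : R.Assumptions) : R.IsPhase R.C' R.θ' R.wopt' R.τ₀ R.T where
  lt := hR.τ₀_lt
  le := le_rfl
  devices_eq := fun _ h _ => if_neg (not_lt.2 h)
  θ_pos := hR.θ'_pos
  isMin := hR.isMin'
  p_le := hR.p_le'
  moments := hR.moments'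
  work_ne := hR.work_ne'

lemma bddBelow (hR : R.Assumptions) (k : ι) : BddBelow (Set.range (R.F k)) :=
  (hR.strong k).bddBelow_range hR.μ_pos (hR.diff k)

lemma gap_nonneg (hR : R.Assumptions) (v : EuclideanSpace ℝ (Fin d)) (k : ι) : 0 ≤ R.gap v k :=
  sub_nonneg.2 (ciInf_le (hR.bddBelow k) v)

lemma neg_gap_le_meanExcess (hR : R.Assumptions) {τ : ℕ} (hτ : τ ≤ R.T)
    (v : EuclideanSpace ℝ (Fin d)) (k : ι) : -R.gap v k ≤ R.meanExcess τ v k := by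
  have := hR.isProb
  have h := integral_mono (integrable_const (-R.gap v k)) (hR.integrable_excess hτ v k) fun ω => by
    have := ciInf_le (hR.bddBelow k) (R.global τ ω)
    simp only [gap]
    linarith
  simpa [meanExcess] using h

end Assumptions

lemma bias_nonneg (R : FedRun d ι Ξ Ω) (A : Finset ι) (r : ℕ) : 0 ≤ R.bias A r := by
  rw [bias]
  split_ifs <;> norm_num

namespace IsPhase

variable {R : FedRun d ι Ξ Ω} {A : Finset ι} {θ : ℝ} {v : EuclideanSpace ℝ (Fin d)} {a b : ℕ}

lemma nonempty (h : R.IsPhase A θ v a b) : A.Nonempty := by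
  rw [Finset.nonempty_iff_ne_empty]
  rintro rfl
  exact h.work_ne (by simp [totalWork])

lemma devices_start (h : R.IsPhase A θ v a b) : R.devices a = A := h.devices_eq a le_rfl h.lt

lemma start_lt (h : R.IsPhase A θ v a b) : a < R.T := h.lt.trans_le h.le

lemma mem_devices (h : R.IsPhase A θ v a b) {k : ι} (hk : k ∈ A) : k ∈ R.devices a := by
  rwa [h.devices_start]

lemma work_nonneg (h : R.IsPhase A θ v a b) (hR : R.Assumptions) {k : ι} (hk : k ∈ A) :
    0 ≤ R.work a k :=
  hR.work_nonneg h.start_lt (h.mem_devices hk)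

lemma totalWork_eq_sum (h : R.IsPhase A θ v a b) (hR : R.Assumptions) :
    R.totalWork A a = ∑ k ∈ A, R.work a k := by
  have := hR.totalWork_eq_sum h.start_lt
  rwa [h.devices_start] at this

lemma totalWork_pos (h : R.IsPhase A θ v a b) (hR : R.Assumptions) : 0 < R.totalWork A a := by
  refine lt_of_le_of_ne ?_ h.work_ne.symm
  rw [h.totalWork_eq_sum hR]
  exact Finset.sum_nonneg fun k hk => h.work_nonneg hR hk

/-- From p ≤ θ p^k, s ≤ E and ∑ p^k = 1. It makes the second entry of the maximum γ at least 4E. -/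
lemma totalWork_le (h : R.IsPhase A θ v a b) (hR : R.Assumptions) :
    R.totalWork A a ≤ θ * R.E := by
  have := hR.isProb
  have hE : (0 : ℝ) ≤ R.E := Nat.cast_nonneg _
  have hk : ∀ k ∈ A, R.work a k ≤ R.weight A k * (θ * R.E) := by
    intro k hk
    have hw := hR.weight_pos hk
    have hk' := h.mem_devices hk
    have hi := integral_mono_ae ((hR.memLp_top_pow_mul h.start_lt hk').1.integrable le_top)
      (integrable_const (R.weight A k * (θ * R.E))) (by
        filter_upwards [h.p_le a le_rfl h.lt k hk, hR.s_le a h.start_lt k hk'] with ω h1 h2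
        rw [div_le_iff₀ hw] at h1
        calc R.p a k ω * (R.s a k ω : ℝ)
            ≤ (θ * R.weight A k) * R.E := by
              have := h.θ_pos
              gcongr
          _ = R.weight A k * (θ * R.E) := by ring)
    simpa [work] using hi
  rw [h.totalWork_eq_sum hR]
  refine (Finset.sum_le_sum hk).trans ?_
  rw [← Finset.sum_mul, hR.sum_weight h.nonempty, one_mul]

lemma four_mul_le_gam (h : R.IsPhase A θ v a b) (hR : R.Assumptions) :
    4 * (R.E : ℝ) ≤ R.gam A θ a := by
  refine le_trans ?_ (le_max_right _ _)
  rw [le_div_iff₀ (h.totalWork_pos hR)]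
  have := mul_le_mul_of_nonneg_left (h.totalWork_le hR) (show (0 : ℝ) ≤ 4 * R.E by positivity)
  linarith

/-- The part of the mean noise that the progress of a round has to pay for. -/
lemma le_integral_noise (h : R.IsPhase A θ v a b) (hR : R.Assumptions) :
    (2 + R.μ / (2 * (1 + θ) * R.L)) * R.E * ((R.E : ℝ) - 1) * R.G ^ 2 * R.totalWork A a
      + R.E * R.G ^ 2 * ∑ k ∈ A, R.sqWork a k / R.weight A k
      ≤ ∫ ω, R.noise A θ v a ω ∂(R.P) := by
  have := hR.isProb
  have hμ := hR.μ_pos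
  have hL := hR.L_pos
  have hθ := h.θ_pos
  have hE : (0 : ℝ) ≤ (R.E : ℝ) - 1 := sub_nonneg.2 (by exact_mod_cast hR.E_pos)
  have hps : ∀ k ∈ A, MemLp (fun ω => R.p a k ω * (R.s a k ω : ℝ)) ∞ R.P := fun k hk =>
    (hR.memLp_top_pow_mul h.start_lt (h.mem_devices hk)).1
  have hpps : ∀ k ∈ A, MemLp (fun ω => R.p a k ω ^ 2 * (R.s a k ω : ℝ)) ∞ R.P := fun k hk =>
    (hR.memLp_top_pow_mul h.start_lt (h.mem_devices hk)).2
  set c := (2 + R.μ / (2 * (1 + θ) * R.L)) * R.E * ((R.E : ℝ) - 1) * R.G ^ 2 with hc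
  have hc0 : 0 ≤ c := by positivity
  set e := (R.E : ℝ) * R.G ^ 2 with he
  have he0 : 0 ≤ e := by positivity
  have s1 : MemLp (fun ω => ∑ k ∈ A, R.p a k ω * (R.s a k ω : ℝ)) ∞ R.P :=
    memLp_finsetSum _ hps
  have s2 : MemLp (fun ω => ∑ k ∈ A, R.p a k ω ^ 2 / R.weight A k * (R.s a k ω : ℝ)) ∞ R.P := by
    refine memLp_finsetSum _ fun k hk => ?_
    convert (hpps k hk).const_mul (R.weight A k)⁻¹ using 2
    ring
  have s3 : MemLp (fun ω => ∑ k ∈ A, R.p a k ω * (R.s a k ω : ℝ) * R.gap v k) ∞ R.P :=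
    memLp_finsetSum _ fun k hk => (hps k hk).mul_const _
  have s4 : MemLp (fun ω => ∑ k ∈ A, R.p a k ω ^ 2 * (R.s a k ω : ℝ) * R.σ k ^ 2) ∞ R.P :=
    memLp_finsetSum _ fun k hk => (hpps k hk).mul_const _
  have s5 : MemLp (fun ω => ∑ k ∈ A, R.p a k ω - 2) ∞ R.P :=
    (memLp_finsetSum _ fun k hk => hR.memLp_top_p h.start_lt (h.mem_devices hk)).sub
      (memLp_const 2)
  have s6 : MemLp (fun ω => max (∑ k ∈ A, R.p a k ω - 2) 0) ∞ R.P := s5.pos_part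
  have s7 : MemLp (fun ω => θ * max (∑ k ∈ A, R.p a k ω - 2) 0
      * ∑ k ∈ A, R.p a k ω * (R.s a k ω : ℝ)) ∞ R.P := s1.mul (s6.const_mul θ)
  have hnoise : MemLp (R.noise A θ v a) ∞ R.P :=
    (((s3.const_mul (2 * (2 + θ) * R.L)).add ((s1.add s7).const_mul c)).add
      (s2.const_mul (2 * R.E * R.G ^ 2))).add s4
  have e1 : ∑ k ∈ A, R.sqWork a k / R.weight A k
      = ∫ ω, ∑ k ∈ A, R.p a k ω ^ 2 / R.weight A k * (R.s a k ω : ℝ) ∂(R.P) := by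
    rw [integral_finsetSum]
    · refine Finset.sum_congr rfl fun k _ => ?_
      rw [sqWork, ← integral_div]
      congr 1 with ω
      ring
    · intro k hk
      have := ((hpps k hk).const_mul (R.weight A k)⁻¹).integrable le_top
      convert this using 2
      ring
  rw [e1, totalWork, ← integral_const_mul, ← integral_const_mul,
    ← integral_add ((s1.const_mul c).integrable le_top) ((s2.const_mul e).integrable le_top)]
  refine integral_mono_ae (((s1.const_mul c).add (s2.const_mul e)).integrable le_top)
    (hnoise.integrable le_top) ?_
  have hp : ∀ᵐ ω ∂(R.P), ∀ k ∈ A, 0 ≤ R.p a k ω :=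
    (Finset.eventually_all _).2 fun k hk => hR.p_nonneg a h.start_lt k (h.mem_devices hk)
  filter_upwards [hp] with ω hω
  have t1 : 0 ≤ ∑ k ∈ A, R.p a k ω * (R.s a k ω : ℝ) :=
    Finset.sum_nonneg fun k hk => mul_nonneg (hω k hk) (Nat.cast_nonneg _)
  have t2 : 0 ≤ ∑ k ∈ A, R.p a k ω ^ 2 / R.weight A k * (R.s a k ω : ℝ) :=
    Finset.sum_nonneg fun k hk => by
      have := hR.weight_pos hk
      positivity
  have t3 : 0 ≤ ∑ k ∈ A, R.p a k ω * (R.s a k ω : ℝ) * R.gap v k :=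
    Finset.sum_nonneg fun k hk =>
      mul_nonneg (mul_nonneg (hω k hk) (Nat.cast_nonneg _)) (hR.gap_nonneg v k)
  have t4 : 0 ≤ ∑ k ∈ A, R.p a k ω ^ 2 * (R.s a k ω : ℝ) * R.σ k ^ 2 :=
    Finset.sum_nonneg fun k hk => by positivity
  have t5 : 0 ≤ c * (θ * max (∑ k ∈ A, R.p a k ω - 2) 0
      * ∑ k ∈ A, R.p a k ω * (R.s a k ω : ℝ)) :=
    mul_nonneg hc0 (mul_nonneg (mul_nonneg hθ.le (le_max_right _ _)) t1)
  have t6 : 0 ≤ 2 * (2 + θ) * R.L * ∑ k ∈ A, R.p a k ω * (R.s a k ω : ℝ) * R.gap v k :=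
    mul_nonneg (by positivity) t3
  have t7 := mul_nonneg he0 t2
  simp only [noise, ← hc]
  -- Half of the squared-coefficient term suffices; the other half, the gap term, the excess term
  -- and the variance term of B are nonnegative and are dropped.
  rw [show 2 * (R.E : ℝ) * R.G ^ 2 = e + e by rw [he]; ring, mul_add c, add_mul e e]
  linarith

lemma integral_noise_nonneg (h : R.IsPhase A θ v a b) (hR : R.Assumptions) :
    0 ≤ ∫ ω, R.noise A θ v a ω ∂(R.P) := by
  have hμ := hR.μ_pos
  have hL := hR.L_pos
  have hθ := h.θ_pos
  have hS := h.totalWork_pos hR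
  have hE : (0 : ℝ) ≤ (R.E : ℝ) - 1 := sub_nonneg.2 (by exact_mod_cast hR.E_pos)
  refine le_trans (add_nonneg (by positivity) (mul_nonneg (by positivity) ?_))
    (h.le_integral_noise hR)
  refine Finset.sum_nonneg fun k hk => div_nonneg ?_ (hR.weight_pos hk).le
  exact integral_nonneg fun ω => by positivity

/-- Only in biased rounds can the mean progress be negative. -/
lemma neg_bias_mul_le_sum (h : R.IsPhase A θ v a b) (hR : R.Assumptions) {τ : ℕ} (ha : a ≤ τ)
    (hb : τ < b) :
    -(R.bias A τ * ∑ k ∈ A, R.work a k * R.gap v k)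
      ≤ ∑ k ∈ A, R.work a k * R.meanExcess τ v k := by
  have hτ : τ < R.T := hb.trans_le h.le
  have hm := (h.moments τ ha hb).1
  rw [bias]
  split_ifs with hc
  -- Unbiased round: 𝔼[p^k s^k] = c p^k, so the sum is c times the mean excess of the global
  -- objective over its minimum.
  · obtain ⟨c, hc⟩ := hc
    have hwork : ∀ k ∈ A, R.work a k = c * R.weight A k := fun k hk => by
      rw [← hm k hk, ← hc k hk, div_mul_cancel₀ _ (hR.weight_pos hk).ne']
    have hc0 : 0 ≤ c := by
      obtain ⟨k, hk⟩ := h.nonempty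
      rw [← hc k hk, hm k hk]
      exact div_nonneg (h.work_nonneg hR hk) (hR.weight_pos hk).le
    rw [zero_mul, neg_zero, Finset.sum_congr rfl fun k hk => by
      rw [hwork k hk, mul_assoc], ← Finset.mul_sum]
    refine mul_nonneg hc0 ?_
    simp only [meanExcess, ← integral_const_mul]
    rw [← integral_finsetSum _ fun k _ => (hR.integrable_excess hτ.le v k).const_mul _]
    refine integral_nonneg fun ω => ?_
    simp only [mul_sub, Finset.sum_sub_distrib, Pi.zero_apply]
    exact sub_nonneg.2 (h.isMin (R.global τ ω))
  · rw [one_mul, ← Finset.sum_neg_distrib]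
    refine Finset.sum_le_sum fun k hk => ?_
    rw [← mul_neg]
    exact mul_le_mul_of_nonneg_left (hR.neg_gap_le_meanExcess hτ.le v k) (h.work_nonneg hR hk)

lemma msd_succ_le (h : R.IsPhase A θ v a b) (hR : R.Assumptions) {τ : ℕ} (ha : a ≤ τ)
    (hb : τ < b) (hη0 : 0 ≤ R.rate τ) (hη : R.rate τ * (2 * (1 + θ) * R.L) ≤ 1) :
    R.msd (τ + 1) v ≤ (1 - R.rate τ * (R.μ * R.totalWork A a) / 2) * R.msd τ v
      + 2 * R.rate τ * R.bias A τ * (∑ k ∈ A, R.work a k * R.gap v k)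
      + R.rate τ ^ 2 * ∫ ω, R.noise A θ v a ω ∂(R.P) := by
  have hμ := hR.μ_pos
  have hL := hR.L_pos
  have hθ := h.θ_pos
  have hS := h.totalWork_pos hR
  have hE : (0 : ℝ) ≤ (R.E : ℝ) - 1 := sub_nonneg.2 (by exact_mod_cast hR.E_pos)
  have hτ : τ < R.T := hb.trans_le h.le
  have hA := h.devices_eq τ ha hb
  obtain ⟨hm1, hm2, -⟩ := h.moments τ ha hb
  have h1 := hR.msd_succ_le hτ (hA.symm ▸ h.nonempty) hη0 v
  have e0 : ∑ k ∈ A, R.sqWork τ k / R.weight A k = ∑ k ∈ A, R.sqWork a k / R.weight A k :=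
    Finset.sum_congr rfl fun k hk => by rw [hm2 k hk]
  rw [hA, Finset.sum_congr rfl fun k hk => by rw [hm1 k hk], e0] at h1
  set Q := R.rate τ ^ 2 * (R.E * ((R.E : ℝ) - 1) * R.G ^ 2) with hQ
  have e1 : ∑ k ∈ A, R.work a k * (2 * R.meanExcess τ v k + R.μ / 2 * R.msd τ v - (R.L + R.μ) * Q)
      = 2 * ∑ k ∈ A, R.work a k * R.meanExcess τ v k
        + R.totalWork A a * (R.μ / 2 * R.msd τ v - (R.L + R.μ) * Q) := by
    rw [h.totalWork_eq_sum hR, Finset.sum_mul, Finset.mul_sum, ← Finset.sum_add_distrib]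
    exact Finset.sum_congr rfl fun k _ => by ring
  rw [e1] at h1
  have h2 := mul_le_mul_of_nonneg_left (h.neg_bias_mul_le_sum hR ha hb)
    (show 0 ≤ 2 * R.rate τ by positivity)
  have h3 := mul_le_mul_of_nonneg_left (h.le_integral_noise hR) (sq_nonneg (R.rate τ))
  -- The step size restriction turns the drift of order η³ into one of order η² with exactly the
  -- constant in B.
  have h4 : R.rate τ * (R.L + R.μ) ≤ 2 + R.μ / (2 * (1 + θ) * R.L) := by
    have hx : R.rate τ ≤ 1 / (2 * (1 + θ) * R.L) := by
      rwa [le_div_iff₀ (by positivity)]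
    have hx1 := mul_le_mul_of_nonneg_right hx hμ.le
    rw [div_mul_eq_mul_div, one_mul] at hx1
    have hx2 : R.rate τ * R.L ≤ 2 := by
      have : 0 ≤ R.rate τ * R.L := by positivity
      have : 0 ≤ R.rate τ * R.L * θ := by positivity
      linarith
    linarith
  have hQ0 : 0 ≤ Q := by positivity
  have h5 := mul_le_mul_of_nonneg_right h4 (mul_nonneg hS.le hQ0)
  have e2 : (2 + R.μ / (2 * (1 + θ) * R.L)) * (R.totalWork A a * Q)
      = R.rate τ ^ 2 * ((2 + R.μ / (2 * (1 + θ) * R.L)) * R.E * ((R.E : ℝ) - 1) * R.G ^ 2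
        * R.totalWork A a) := by
    rw [hQ]
    ring
  rw [e2] at h5
  linarith

/-- Convergence within a phase that starts with a fresh learning rate. -/
theorem msd_le (h : R.IsPhase A θ v a b) (hR : R.Assumptions)
    (hrate : ∀ τ, a ≤ τ → τ < b → R.rate τ = 16 * R.E / (R.μ * R.totalWork A a)
      * (1 / (((τ : ℝ) - a) * R.E + R.gam A θ a)))
    {V₁ : ℝ} (hV₁ : R.gam A θ a ^ 2 * R.msd a v ≤ V₁) {τ : ℕ} (ha : a ≤ τ) (hb : τ ≤ b) :
    R.msd τ v ≤ (R.biasCount A a τ * R.driftConst A v a + R.varConst A θ v a V₁)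
      / (((τ : ℝ) - a) * R.E + R.gam A θ a) := by
  have hμ := hR.μ_pos
  have hL := hR.L_pos
  have hθ := h.θ_pos
  have hS := h.totalWork_pos hR
  have hE : (1 : ℝ) ≤ R.E := by exact_mod_cast hR.E_pos
  have hE0 : (0 : ℝ) < R.E := by linarith
  have hγ := h.four_mul_le_gam hR
  have hmsd : ∀ τ, 0 ≤ R.msd τ v := fun τ => integral_nonneg fun ω => by positivity
  induction τ, ha using Nat.le_induction with
  | base =>
    have hγ0 : 0 < R.gam A θ a := by linarith
    rw [biasCount, Finset.Ico_self, Finset.sum_empty, zero_mul, zero_add, sub_self, zero_mul,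
      zero_add, le_div_iff₀ hγ0]
    refine le_trans ?_ (hV₁.trans (le_max_left _ _))
    rw [mul_comm]
    -- Here γ ≤ γ², because γ ≥ 4E ≥ 1.
    exact mul_le_mul_of_nonneg_right (by nlinarith) (hmsd a)
  | succ τ ha ih =>
    have hb' : τ < b := hb
    have hτa : (0 : ℝ) ≤ (τ : ℝ) - a := sub_nonneg.2 (by exact_mod_cast ha)
    set x := ((τ : ℝ) - a) * R.E + R.gam A θ a with hx
    set β := 16 * (R.E : ℝ) / (R.μ * R.totalWork A a) with hβ
    have hγx : R.gam A θ a ≤ x := by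
      have := mul_nonneg hτa hE0.le
      linarith
    have hx0 : 0 < x := by linarith
    have hβ0 : 0 < β := by positivity
    have hr : R.rate τ = β / x := by
      rw [hrate τ ha hb', mul_one_div]
    -- The first entry of the maximum γ is exactly β · 2(1 + θ)L.
    have hηle : R.rate τ * (2 * (1 + θ) * R.L) ≤ 1 := by
      rw [hr, div_mul_eq_mul_div, div_le_one hx0]
      refine le_trans (le_of_eq ?_) ((le_max_left _ _).trans hγx)
      rw [hβ]
      ring
    have hstep := h.msd_succ_le hR ha hb' (by rw [hr]; positivity) hηle
    rw [hr] at hstep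
    have hW : 0 ≤ ∑ k ∈ A, R.work a k * R.gap v k :=
      Finset.sum_nonneg fun k hk => mul_nonneg (h.work_nonneg hR hk) (hR.gap_nonneg v k)
    have hfin := sgd_recursion_step hE0 (hγ.trans hγx) hβ0
      (q := R.μ * R.totalWork A a) (by rw [hβ]; field_simp) hW
      (D := R.driftConst A v a) (by rw [driftConst, hβ]; ring)
      (Finset.sum_nonneg fun t _ => R.bias_nonneg A t) (R.bias_nonneg A τ)
      (h.integral_noise_nonneg hR) (V := R.varConst A θ v a V₁) (le_max_right _ _) (hmsd τ)
      (ih hb'.le) hstep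
    rw [biasCount, Finset.sum_Ico_succ_top ha]
    convert hfin using 2
    rw [hx]
    push_cast
    ring

end IsPhase

/-! ### Displacement of the minimizer when a device joins or leaves. -/

/-- The gradient of the global objective of the set `A`. -/
noncomputable def objGrad (R : FedRun d ι Ξ Ω) (A : Finset ι) (w : EuclideanSpace ℝ (Fin d)) :
    EuclideanSpace ℝ (Fin d) :=
  ∑ k ∈ A, R.weight A k • ∇ (R.F k) w

lemma sum_mul_weight_smul (R : FedRun d ι Ξ Ω) {M : Type*} [AddCommGroup M] [Module ℝ M]
    {A : Finset ι} (hN : ∑ j ∈ A, (R.n j : ℝ) ≠ 0) (f : ι → M) :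
    (∑ j ∈ A, (R.n j : ℝ)) • ∑ k ∈ A, R.weight A k • f k = ∑ k ∈ A, (R.n k : ℝ) • f k := by
  rw [Finset.smul_sum]
  refine Finset.sum_congr rfl fun k _ => ?_
  rw [smul_smul, weight, mul_div_cancel₀ _ hN]

/-- The first term of `Ṽ` in terms of bounds for its two ingredients. -/
lemma VNewFirst_le (R : FedRun d ι Ξ Ω) {Δ κ Y c Γ : ℝ} (hΔ0 : 0 ≤ Δ) (hY : 0 ≤ Y) (hΔ : Δ ≤ κ * Y) (hc : 0 ≤ c)
    (hΓ : 0 ≤ Γ) (hd : ‖R.wopt - R.wopt'‖ ^ 2 ≤ c * Γ) :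
    R.VNewFirst Δ ≤ 2 * R.gamNew ^ 2 * (|κ| + c) * (Y + Γ) := by
  have h1 : (√Δ + ‖R.wopt - R.wopt'‖) ^ 2 ≤ 2 * (|κ| + c) * (Y + Γ) := by
    have h2 := add_sq_le (a := √Δ) (b := ‖R.wopt - R.wopt'‖)
    rw [Real.sq_sqrt hΔ0] at h2
    -- κ itself may be negative when Y = 0, hence |κ|.
    have h3 := hΔ.trans (mul_le_mul_of_nonneg_right (le_abs_self κ) hY)
    have h4 := mul_nonneg (abs_nonneg κ) hΓ
    have h5 := mul_nonneg hc hY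
    linarith
  have := mul_le_mul_of_nonneg_left h1 (sq_nonneg R.gamNew)
  rw [VNewFirst]
  linarith

namespace Assumptions

variable {R : FedRun d ι Ξ Ω}

lemma sum_n_pos (hR : R.Assumptions) {A : Finset ι} (hA : A.Nonempty) :
    0 < ∑ j ∈ A, (R.n j : ℝ) :=
  Finset.sum_pos (fun j _ => Nat.cast_pos.2 (hR.n_pos j)) hA

lemma le_objective (hR : R.Assumptions) {A : Finset ι} (hA : A.Nonempty)
    (x y : EuclideanSpace ℝ (Fin d)) :
    R.objective A x + inner ℝ (R.objGrad A x) (y - x) + R.μ / 2 * ‖y - x‖ ^ 2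
      ≤ R.objective A y := by
  have h : ∑ k ∈ A, R.weight A k * (R.F k x + inner ℝ (∇ (R.F k) x) (y - x)
      + R.μ / 2 * ‖y - x‖ ^ 2) ≤ R.objective A y :=
    Finset.sum_le_sum fun k hk => mul_le_mul_of_nonneg_left
      ((hR.strong k).add_inner_gradient_le (hR.diff k) x y) (hR.weight_pos hk).le
  simpa only [mul_add, Finset.sum_add_distrib, ← Finset.sum_mul, hR.sum_weight hA, one_mul,
    objective, objGrad, sum_inner, real_inner_smul_left] using h

lemma objective_le (hR : R.Assumptions) {A : Finset ι} (hA : A.Nonempty)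
    (x y : EuclideanSpace ℝ (Fin d)) :
    R.objective A y
      ≤ R.objective A x + inner ℝ (R.objGrad A x) (y - x) + R.L / 2 * ‖y - x‖ ^ 2 := by
  have h : R.objective A y ≤ ∑ k ∈ A, R.weight A k * (R.F k x + inner ℝ (∇ (R.F k) x) (y - x)
      + R.L / 2 * ‖y - x‖ ^ 2) :=
    Finset.sum_le_sum fun k hk => mul_le_mul_of_nonneg_left
      (le_add_inner_gradient_add (hR.diff k) (hR.smooth k) x y) (hR.weight_pos hk).le
  simpa only [mul_add, Finset.sum_add_distrib, ← Finset.sum_mul, hR.sum_weight hA, one_mul,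
    objective, objGrad, sum_inner, real_inner_smul_left] using h

/-- A gradient step of length 1/L from v would otherwise lower the objective strictly. -/
lemma objGrad_eq_zero (hR : R.Assumptions) {A : Finset ι} (hA : A.Nonempty)
    {v : EuclideanSpace ℝ (Fin d)} (hv : ∀ w, R.objective A v ≤ R.objective A w) :
    R.objGrad A v = 0 := by
  have hL := hR.L_pos
  have h := (hv (v - R.L⁻¹ • R.objGrad A v)).trans (hR.objective_le hA v _)
  rw [sub_sub_cancel_left, norm_neg, inner_neg_right, inner_smul_right, norm_smul, mul_pow,
    real_inner_self_eq_norm_sq, Real.norm_of_nonneg (inv_pos.2 hL).le] at h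
  have e : R.L / 2 * (R.L⁻¹ ^ 2 * ‖R.objGrad A v‖ ^ 2) = R.L⁻¹ * ‖R.objGrad A v‖ ^ 2 / 2 := by
    field_simp
  have h1 : R.L⁻¹ * ‖R.objGrad A v‖ ^ 2 ≤ 0 := by linarith
  have h2 : ‖R.objGrad A v‖ ^ 2 ≤ 0 := by
    rwa [inv_mul_le_iff₀ hL, mul_zero] at h1
  exact norm_eq_zero.1 (pow_eq_zero_iff two_ne_zero |>.1 (le_antisymm h2 (sq_nonneg _)))

/-- Quadratic growth of the global objective at its minimizer. -/
lemma objective_growth (hR : R.Assumptions) {A : Finset ι} (hA : A.Nonempty)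
    {v : EuclideanSpace ℝ (Fin d)} (hv : ∀ w, R.objective A v ≤ R.objective A w)
    (w : EuclideanSpace ℝ (Fin d)) :
    R.μ / 2 * ‖w - v‖ ^ 2 ≤ R.objective A w - R.objective A v := by
  have h := hR.le_objective hA v w
  rw [hR.objGrad_eq_zero hA hv, inner_zero_left] at h
  linarith

/-- The minimizers with and without device `l` are close if the minimizer without it is nearly
optimal for `l`. -/
lemma norm_sub_sq_le_gap_of_cons (hR : R.Assumptions) {A : Finset ι} (hA : A.Nonempty) {l : ι}
    (hl : l ∉ A) {v v' : EuclideanSpace ℝ (Fin d)}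
    (hv : ∀ w, R.objective A v ≤ R.objective A w)
    (hv' : ∀ w, R.objective (A.cons l hl) v' ≤ R.objective (A.cons l hl) w) :
    ‖v - v'‖ ^ 2 ≤ 2 / R.μ * R.gap v l := by
  have hμ := hR.μ_pos
  have hA' : (A.cons l hl).Nonempty := Finset.cons_nonempty hl
  have hN := hR.sum_n_pos hA
  have hN' := hR.sum_n_pos hA'
  have hg := hR.objective_growth hA' hv' v
  -- Unnormalized, the two objectives differ by n_l F_l. As v is optimal without l, its excess for
  -- the larger set is at most the share of l times its gap; bounding the share by 1 frees the
  -- constant from the data sizes.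
  have hobj : ∀ w, (∑ j ∈ A.cons l hl, (R.n j : ℝ)) * R.objective (A.cons l hl) w
      = R.n l * R.F l w + (∑ j ∈ A, (R.n j : ℝ)) * R.objective A w := by
    intro w
    have h1 := R.sum_mul_weight_smul hN'.ne' (fun k => R.F k w)
    have h2 := R.sum_mul_weight_smul hN.ne' (fun k => R.F k w)
    simp only [smul_eq_mul] at h1 h2
    rw [objective, objective, h1, h2, Finset.sum_cons]
  have hF : R.F l v - R.F l v' ≤ R.gap v l := by
    have := ciInf_le (hR.bddBelow l) v'
    rw [gap]
    linarith
  have hn : (R.n l : ℝ) ≤ ∑ j ∈ A.cons l hl, (R.n j : ℝ) := by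
    rw [Finset.sum_cons]
    linarith
  have h3 : (∑ j ∈ A.cons l hl, (R.n j : ℝ))
      * (R.objective (A.cons l hl) v - R.objective (A.cons l hl) v')
      ≤ (∑ j ∈ A.cons l hl, (R.n j : ℝ)) * R.gap v l := by
    rw [mul_sub, hobj, hobj]
    have h4 := mul_le_mul_of_nonneg_left (hv v') hN.le
    have h5 := mul_le_mul_of_nonneg_left hF (Nat.cast_nonneg (α := ℝ) (R.n l))
    have h6 := mul_le_mul_of_nonneg_right hn (hR.gap_nonneg v l)
    linarith
  have h7 := hg.trans (le_of_mul_le_mul_left h3 hN')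
  rw [div_mul_eq_mul_div, le_div_iff₀ hμ]
  linarith

/-- The minimizers with and without device `l` are close if the minimizer with it is nearly
optimal for `l`, and `l` does not dominate. -/
lemma norm_sub_sq_le_gap_of_cons' (hR : R.Assumptions) {A : Finset ι} (hA : A.Nonempty) {l : ι}
    (hl : l ∉ A) {v v' : EuclideanSpace ℝ (Fin d)}
    (hv : ∀ w, R.objective A v ≤ R.objective A w)
    (hv' : ∀ w, R.objective (A.cons l hl) v' ≤ R.objective (A.cons l hl) w) :
    ‖v' - v‖ ^ 2 ≤ 2 * R.L * (R.n l / ∑ k ∈ A, (R.n k : ℝ)) ^ 2 / R.μ ^ 2 * R.gap v' l := by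
  have hμ := hR.μ_pos
  have hL := hR.L_pos
  have hA' : (A.cons l hl).Nonempty := Finset.cons_nonempty hl
  have hN := hR.sum_n_pos hA
  have hN' := hR.sum_n_pos hA'
  set r := (R.n l : ℝ) / ∑ k ∈ A, (R.n k : ℝ) with hr
  have hr0 : 0 ≤ r := by positivity
  have h1 := R.sum_mul_weight_smul hN'.ne' (fun k => ∇ (R.F k) v')
  have h2 := R.sum_mul_weight_smul hN.ne' (fun k => ∇ (R.F k) v')
  have h0 : ∑ k ∈ A.cons l hl, R.weight (A.cons l hl) k • ∇ (R.F k) v' = 0 :=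
    hR.objGrad_eq_zero hA' hv'
  rw [h0, smul_zero, Finset.sum_cons, ← h2] at h1
  -- At v' the contribution of l balances that of A, so the gradient without l is a multiple of the
  -- one of l.
  have hgrad : R.objGrad A v' = -(r • ∇ (R.F l) v') := by
    have h3 := eq_neg_of_add_eq_zero_right h1.symm
    have h4 : R.objGrad A v' = (∑ j ∈ A, (R.n j : ℝ))⁻¹ • ((∑ j ∈ A, (R.n j : ℝ))
        • ∑ k ∈ A, R.weight A k • ∇ (R.F k) v') := by
      rw [smul_smul, inv_mul_cancel₀ hN.ne', one_smul, objGrad]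
    rw [h4, h3, smul_neg, smul_smul, hr, div_eq_inv_mul]
  have h5 := hR.le_objective hA v' v
  have h6 := hR.objective_growth hA hv v'
  rw [hgrad, inner_neg_left, real_inner_smul_left, norm_sub_rev v v'] at h5
  have h7 := real_inner_le_norm (∇ (R.F l) v') (v - v')
  rw [norm_sub_rev v v'] at h7
  have h8 := mul_le_mul_of_nonneg_left h7 hr0
  -- Strong convexity at v' and quadratic growth at v add up to μ‖v' - v‖² ≤ r⟨∇F_l(v'), v - v'⟩.
  -- The gradient is then bounded through the gap by `norm_gradient_sq_le`.
  have h9 : R.μ * ‖v' - v‖ ≤ r * ‖∇ (R.F l) v'‖ := by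
    rcases (norm_nonneg (v' - v)).eq_or_lt with h | h
    · rw [← h, mul_zero]
      positivity
    · refine le_of_mul_le_mul_right ?_ h
      nlinarith
  have h10 : (R.μ * ‖v' - v‖) ^ 2 ≤ (r * ‖∇ (R.F l) v'‖) ^ 2 := by gcongr
  have h11 := mul_le_mul_of_nonneg_left
    (norm_gradient_sq_le hL (hR.diff l) (hR.smooth l) (hR.bddBelow l) v') (sq_nonneg r)
  rw [div_mul_eq_mul_div, le_div_iff₀ (by positivity)]
  rw [mul_pow, mul_pow] at h10
  rw [gap]
  linarith

lemma VOld_div_nonneg (hR : R.Assumptions) : 0 ≤ R.VOld / (R.τ₀ * R.E + R.gamOld) := by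
  have h := hR.isPhase_old.four_mul_le_gam hR
  have hE : (0 : ℝ) ≤ R.E := Nat.cast_nonneg _
  have hV : 0 ≤ R.VOld := by
    refine le_trans ?_ (le_max_left _ _)
    exact mul_nonneg (sq_nonneg _) (integral_nonneg fun ω => by positivity)
  refine div_nonneg hV (add_nonneg (by positivity) ?_)
  exact le_trans (by positivity) h

end Assumptions

end FedRun

/-! ### The two phases combined. -/

theorem corollary3p1 :
    ∃ (K₁ : ℝ → ℝ → ℝ → ℝ → ℝ) (K₂ : ℝ → ℝ → ℝ → ℝ → ℝ → ℝ),
    ∀ {d : ℕ} {ι Ξ Ω : Type*} [MeasurableSpace Ξ] [MeasurableSpace Ω] (R : FedRun d ι Ξ Ω),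
    R.Assumptions →
    -- what the training before the shift provides for `Δ`
    ((∀ τ < R.τ₀, R.η₀ τ = 16 * R.E / (R.μ * R.totalWork R.C 0) * (1 / (τ * R.E + R.gamOld))) →
      R.msd R.τ₀ R.wopt
        ≤ (R.biasCount R.C 0 R.τ₀ * R.DOld + R.VOld) / (R.τ₀ * R.E + R.gamOld)) ∧
    ∀ Δ : ℝ, R.msd R.τ₀ R.wopt ≤ Δ →
      -- convergence to the new optimum
      (∀ τ, R.τ₀ ≤ τ → τ ≤ R.T →
        Integrable (fun ω => ‖R.global τ ω - R.wopt'‖ ^ 2) R.P ∧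
        R.msd τ R.wopt' ≤ (R.biasCount R.C' R.τ₀ τ * R.DNew + R.VNew Δ)
          / (((τ : ℝ) - R.τ₀) * R.E + R.gamNew)) ∧
      -- size of the first term of `Ṽ`
      (∀ κ : ℝ, Δ ≤ κ * (R.VOld / (R.τ₀ * R.E + R.gamOld)) →
        (R.Arrival →
          R.VNewFirst Δ ≤ K₁ κ R.gamNew R.L R.μ *
            (R.VOld / (R.τ₀ * R.E + R.gamOld) + R.gap R.wopt R.l)) ∧
        (R.Departure →
          R.VNewFirst Δ ≤ K₁ κ R.gamNew R.L R.μ *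
            (R.VOld / (R.τ₀ * R.E + R.gamOld) + R.gap R.wopt' R.l) ∧
          R.VNewFirst Δ ≤ K₂ κ R.gamNew R.L R.μ (R.n R.l / ∑ k ∈ R.C', (R.n k : ℝ)) *
            (R.VOld / (R.τ₀ * R.E + R.gamOld) + R.gap R.wopt R.l))) := by

  -- The constants of `VNewFirst_le` with c = 2/μ and c = 2Lr²/μ², the factors in the two bounds for
  -- the displacement.
  refine ⟨fun κ g _ μ => 2 * g ^ 2 * (|κ| + 2 / μ),
    fun κ g L μ r => 2 * g ^ 2 * (|κ| + 2 * L * r ^ 2 / μ ^ 2), ?_⟩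
  intro d ι Ξ Ω _ _ R hR
  have hprob := hR.isProb
  have hμ := hR.μ_pos
  have hL := hR.L_pos
  refine ⟨fun hη => ?_, fun Δ hΔ => ⟨fun τ h1 h2 => ⟨?_, ?_⟩, fun κ hκ => ?_⟩⟩
  · have h := hR.isPhase_old.msd_le hR (fun τ _ hτ => by
      rw [FedRun.rate, if_pos hτ, hη τ hτ, Nat.cast_zero, sub_zero]
      rfl) (le_refl (R.gamOld ^ 2 * R.msd 0 R.wopt)) hR.τ₀_pos.le le_rfl
    rw [Nat.cast_zero, sub_zero] at h
    exact h
  · exact integrable_norm_sq_of_memLp (hR.memLp_global_sub h2 _)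
  · refine hR.isPhase_new.msd_le hR (fun τ hτ _ => ?_)
      (mul_le_mul_of_nonneg_left ?_ (sq_nonneg _)) h1 h2
    · rw [FedRun.rate, if_neg (not_lt.2 hτ)]
      rfl
    -- The change of reference point from the old optimum to the new one.
    · exact integral_norm_sub_sq_le (hR.memLp_global hR.τ₀_lt.le) _ _ hΔ
  · have hΔ0 : 0 ≤ Δ := le_trans (integral_nonneg fun ω => by positivity) hΔ
    have hY := hR.VOld_div_nonneg
    refine ⟨fun harr => ?_, fun hdep => ?_⟩
    · have hC : R.C' = R.C.cons R.l harr.1 := by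
        ext k
        rw [harr.2, Finset.mem_cons]
      exact R.VNewFirst_le hΔ0 hY hκ (by positivity) (hR.gap_nonneg _ _)
        (hR.norm_sub_sq_le_gap_of_cons hR.isPhase_old.nonempty harr.1 hR.isMin
          (hC ▸ hR.isMin'))
    · have hl : R.l ∉ R.C' := fun h => ((hdep.2 _).1 h).1 rfl
      have hC : R.C = R.C'.cons R.l hl := by
        ext k
        rw [Finset.mem_cons, hdep.2]
        by_cases hk : k = R.l
        · simp [hk, hdep.1]
        · simp [hk]
      -- Now the new set is the one without l, so its optimum takes the role that the old optimum
      -- has on arrival; the gap at the old optimum needs the gradient comparison.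
      refine ⟨?_, ?_⟩
      · refine R.VNewFirst_le hΔ0 hY hκ (by positivity) (hR.gap_nonneg _ _) ?_
        rw [norm_sub_rev]
        exact hR.norm_sub_sq_le_gap_of_cons hR.isPhase_new.nonempty hl hR.isMin'
          (hC ▸ hR.isMin)
      · exact R.VNewFirst_le hΔ0 hY hκ (by positivity) (hR.gap_nonneg _ _)
          (hR.norm_sub_sq_le_gap_of_cons' hR.isPhase_new.nonempty hl hR.isMin'
            (hC ▸ hR.isMin))
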